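/- \textbf{Setting.} Let $d\ge 2$, $\beta>0$, let $\mathbb T^d=(\mathbb R/\mathbb Z)^d$ be the flat torus, $\mathcal D=\mathbb T^d\times\mathbb R^d$, and let $N\ge 1$, $\varepsilon>0$ satisfy $N\varepsilon^{d-1}=1$. For $n\ge 1$ let $\mathcal D_n^\varepsilon$ be the set of $\underline z_n=(x_i,v_i)_{i\le n}\in\mathcal D^n$ with $|x_i-x_j|\ge\varepsilon$ for all $i\ne j$, and let $\Theta_n(t)$ be the transport by the hard-sphere dynamics in $\mathcal D_n^\varepsilon$ with specular reflection (uniform motion and elastic binary collisions, defined almost everywhere): $(\Theta_n(t)f)(\underline z_n)$ is the value of $f$ at the configuration from which the dynamics reaches $\underline z_n$ in time $t$, and it is $0$ if there is no such configuration. Let $$C_nf(\underline z_n)=(N-n)\varepsilon^{d-1}\sum_{i=1}^n\int_{\mathbb R^d}\int_{\mathbb S^{d-1}}\omega\cdot(v_{n+1}-v_i)\,f(\underline z_n,x_i+\varepsilon\omega,v_{n+1})\,d\omega\,dv_{n+1},$$ $$Q_{n,n+s}(t)=\int_0^t\int_0^{t_1}\!\!\cdots\int_0^{t_{s-1}}\Theta_n(t-t_1)C_n\Theta_{n+1}(t_1-t_2)C_{n+1}\cdots\Theta_{n+s}(t_s)\,dt_s\cdots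 dt_1,\qquad Q_{n,n}(t)=\Theta_n(t).$$ Let $M_\beta(v)=(\beta/2\pi)^{d/2}e^{-\beta|v|^2/2}$, let $\rho$ be a continuous real function on $\mathbb T^d$, $\|\rho\|=\|\rho\|_{L^\infty(\mathbb T^d)}$, and $$f_N(0,\underline z_N)=\frac{1}{\mathcal Z_N}\mathbf 1_{\mathcal D_N^\varepsilon}(\underline z_N)\,\rho(x_1)\prod_{i=1}^NM_\beta(v_i),\qquad \mathcal Z_N=\int_{\mathcal D_N^\varepsilon}\prod_{i=1}^NM_\beta(v_i)\,d\underline z_N,$$ with the convention $f_N=0$ if $\mathcal Z_N=0$. (If $\rho\ge 0$ and $\int\rho=1$ and $\mathcal Z_N>0$, this is a probability density.) Let $f_N(t)=\Theta_N(t)f_N(0)$, let $f_N^{(n)}(t)$ be its marginal in the first $n$ particles for $1\le n\le N$, and $f_N^{(n)}(t)=0$ for $n>N$. Given $t>0$, $K\ge1$ and $h_1,\dots,h_K>0$ with $h_1+\dots+h_K=t$, put $t^{\mathrm p}_k=t-(h_1+\dots+h_k)$ and $J_i=1+j_1+\dots+j_i$ (with $J_0=1$). The pruned-out remainder, a function on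 $\mathcal D$, is $$R^{[K]}(t)=\sum_{k=1}^K\ \sum_{j_1=0}^{2^1-1}\cdots\sum_{j_{k-1}=0}^{2^{k-1}-1}Q_{1,J_1}(h_1)\cdots Q_{J_{k-2},J_{k-1}}(h_{k-1})\sum_{s\ge 2^k}Q_{J_{k-1},J_{k-1}+s}(h_k)\,f_N^{(J_{k-1}+s)}(t^{\mathrm p}_k).$$ \textbf{Proposition (estimate of the pruned-out term).} There is a constant $c>0$ depending only on $d$ and $\beta$ such that for every $\alpha\in(0,\tfrac12)$ there is $K_0$, depending only on $d,\beta,\alpha$, with the following property. For every integer $K\ge K_0$ and every $t$ with $0<t\le cK^{\frac12-\alpha}$ there are $h_1,\dots,h_K>0$ with $h_1+\dots+h_K=t$ such that, for all $N\ge1$ and $\varepsilon>0$ with $N\varepsilon^{d-1}=1$ and all continuous $\rho$, $$\bigl\|R^{[K]}(t)\bigr\|_{L^\infty(\mathcal D)}\le\|\rho\|\,e^{-2^{K-K^{1-\alpha}}}.$$ -/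

import Mathlib

open scoped RealInnerProductSpace ENNReal
open MeasureTheory

noncomputable section

namespace HardSphere

/-- The space `ℝ^d` of velocities, with its Euclidean norm. -/
abbrev Vel (d : ℕ) : Type := EuclideanSpace ℝ (Fin d)

/-- The torus `𝕋^d = (ℝ/ℤ)^d`, with its Haar probability measure as `volume`. -/
abbrev Torus (d : ℕ) : Type := UnitAddTorus (Fin d)

/-- One-particle phase space `𝕋^d × ℝ^d`. -/
abbrev Phase (d : ℕ) : Type := Torus d × Vel d

/-- Configurations `(z₁, …, zₙ)` of `n` particles, `z_i = (x_i, v_i)`. -/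
abbrev Config (d n : ℕ) : Type := Fin n → Phase d

/-- A function of `n` particles for every `n`, such as the collection of all marginals. -/
abbrev Family (d : ℕ) : Type := (n : ℕ) → Config d n → ℝ

/-- The projection `ℝ^d → 𝕋^d`. -/
def toTorus {d : ℕ} (w : Vel d) : Torus d := fun k => ((w k : ℝ) : UnitAddCircle)

/-- The displacement `x - y ∈ ℝ^d` of two points of the torus: the representative of the class
`x - y` with all coordinates in `(-1/2, 1/2]`, which is a representative of minimal norm. -/
def disp {d : ℕ} (x y : Torus d) : Vel d :=
  WithLp.toLp 2 fun k => ((AddCircle.equivIoc (1 : ℝ) (-1 / 2) (x k - y k) : ℝ))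

/-- The Euclidean (geodesic) distance `|x - y|` on the flat torus. -/
def torusDist {d : ℕ} (x y : Torus d) : ℝ := ‖disp x y‖

/-- The hard-sphere domain of `n` particles of diameter `ε`, with its boundary. The boundary is a
null set; it is included because collision operators evaluate functions at contact. -/
def domain (d : ℕ) (ε : ℝ) (n : ℕ) : Set (Config d n) :=
  {z | ∀ i j, i ≠ j → ε ≤ torusDist (z i).1 (z j).1}

/-- Uniform motion of all particles during a time `s`. -/
def free {d n : ℕ} (s : ℝ) (z : Config d n) : Config d n :=
  fun i => ((z i).1 + toTorus (s • (z i).2), (z i).2)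

/-- The configuration `z` is about to undergo a collision between `i` and `j`: these two particles
are in contact with `(x_i - x_j) · (v_i - v_j) < 0`, and no other pair is in contact. -/
def Colliding {d n : ℕ} (ε : ℝ) (z : Config d n) (i j : Fin n) : Prop :=
  i ≠ j ∧ torusDist (z i).1 (z j).1 = ε ∧
    ⟪(z i).2 - (z j).2, disp (z i).1 (z j).1⟫ < 0 ∧
    ∀ k l, k ≠ l → torusDist (z k).1 (z l).1 = ε → (k = i ∧ l = j) ∨ (k = j ∧ l = i)

/-- Specular reflection of particles `i` and `j`: the velocities become
`v_i' = v_i - ε⁻² [(v_i - v_j) · (x_i - x_j)] (x_i - x_j)` and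
`v_j' = v_j + ε⁻² [(v_i - v_j) · (x_i - x_j)] (x_i - x_j)`. -/
def scatter {d n : ℕ} (ε : ℝ) (z : Config d n) (i j : Fin n) : Config d n :=
  let r := disp (z i).1 (z j).1
  let c := (ε ^ 2)⁻¹ * ⟪(z i).2 - (z j).2, r⟫
  Function.update (Function.update z i ((z i).1, (z i).2 - c • r)) j ((z j).1, (z j).2 + c • r)

/-- `Evolves ε z τ z'`: the hard-sphere dynamics brings `z` to `z'` in a time `τ`, by uniform
motion inside the domain interrupted by finitely many binary elastic collisions. A collision may
take place at the final time, so that `z'` may be a post-collisional configuration. -/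
inductive Evolves {d n : ℕ} (ε : ℝ) : Config d n → ℝ → Config d n → Prop
  | free (z : Config d n) (τ : ℝ) (hτ : 0 ≤ τ)
      (hdom : ∀ s ∈ Set.Icc 0 τ, HardSphere.free s z ∈ domain d ε n) :
      Evolves ε z τ (HardSphere.free τ z)
  | collision (z : Config d n) (τ₁ τ₂ : ℝ) (z' : Config d n) (i j : Fin n) (hτ : 0 < τ₁)
      (hdom : ∀ s ∈ Set.Icc 0 τ₁, HardSphere.free s z ∈ domain d ε n)
      (hcoll : Colliding ε (HardSphere.free τ₁ z) i j)
      (hnext : Evolves ε (scatter ε (HardSphere.free τ₁ z) i j) τ₂ z') :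
      Evolves ε z (τ₁ + τ₂) z'

open Classical in
/-- The transport operator `Θ_n(t)` with specular reflection: `(Θ_n(t) f)(z') = f(z)`, where `z` is
the configuration that the dynamics brings to `z'` in a time `t`. It is set to be `0` outside of
the domain and at the (negligible) configurations with no well-defined backward trajectory. -/
def Θ {d : ℕ} (ε : ℝ) (n : ℕ) (t : ℝ) (f : Config d n → ℝ) : Config d n → ℝ :=
  fun z' => if h : ∃ z, Evolves ε z t z' then f h.choose else 0

/-- The collision operator `C_n`, from functions of `n + 1` particles to functions of `n`
particles; `dω` is the surface measure of the unit sphere. -/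
def C {d : ℕ} (ε : ℝ) (N n : ℕ) (f : Config d (n + 1) → ℝ) : Config d n → ℝ :=
  fun z => ((N : ℝ) - n) * ε ^ (d - 1) * ∑ i : Fin n,
    ∫ v : Vel d, ∫ ω : Metric.sphere (0 : Vel d) 1,
      ⟪(ω : Vel d), v - (z i).2⟫ *
        f (Fin.snoc (α := fun _ => Phase d) z ((z i).1 + toTorus (ε • (ω : Vel d)), v))
      ∂(volume : Measure (Vel d)).toSphere

/-- The successive-collision operator `Q_{n,n+s}(t)`, applied to the member `F (n + s)` of `F`:
`∫_0^t ∫_0^{t₁} ⋯ ∫_0^{t_{s-1}} Θ_n(t-t₁) C_n Θ_{n+1}(t₁-t₂) C_{n+1} ⋯ Θ_{n+s}(t_s) dt_s ⋯ dt₁`. -/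
def Q {d : ℕ} (ε : ℝ) (N : ℕ) : (n s : ℕ) → (t : ℝ) → Family d → Config d n → ℝ
  | n, 0, t, F => Θ ε n t (F n)
  | n, s + 1, t, F => fun z =>
      ∫ t₁ in (0 : ℝ)..t, Θ ε n (t - t₁) (C ε N n (Q ε N (n + 1) s t₁ F)) z

/-- The Maxwell state `M_β(v) = (β / 2π)^{d/2} exp(-β|v|²/2)`. -/
def maxwell {d : ℕ} (β : ℝ) (v : Vel d) : ℝ :=
  (β / (2 * Real.pi)) ^ ((d : ℝ) / 2) * Real.exp (-(β / 2) * ‖v‖ ^ 2)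

/-- The unnormalized Gibbs weight: `M_β^{⊗n}` restricted to the hard-sphere domain. -/
def gibbs {d : ℕ} (ε β : ℝ) (n : ℕ) : Config d n → ℝ :=
  (domain d ε n).indicator fun z => ∏ i, maxwell β (z i).2

/-- The partition function `𝒵_N`. By invariance under translations it is the normalization constant
of `ρ(x₁) M_β^{⊗N}` on the hard-sphere domain whenever `ρ` has integral `1`. -/
def partitionZ (d : ℕ) (ε β : ℝ) (N : ℕ) : ℝ := ∫ z : Config d N, gibbs ε β N z

/-- The initial density `f_N(0)`: the Gibbs state, perturbed by `ρ` on the first particle. -/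
def initialDensity {d : ℕ} (ε β : ℝ) (ρ : Torus d → ℝ) (N : ℕ) [NeZero N] : Config d N → ℝ :=
  fun z => (partitionZ d ε β N)⁻¹ * ρ (z 0).1 * gibbs ε β N z

/-- The density `f_N(t)`, the solution of the Liouville equation with specular reflection. -/
def density {d : ℕ} (ε β : ℝ) (ρ : Torus d → ℝ) (N : ℕ) [NeZero N] (t : ℝ) : Config d N → ℝ :=
  Θ ε N t (initialDensity ε β ρ N)

/-- The marginals `f_N^{(n)}(t)`, with `f_N^{(n)}(t) = 0` for `n > N`. -/
def marginal {d : ℕ} (ε β : ℝ) (ρ : Torus d → ℝ) (N : ℕ) [NeZero N] (t : ℝ) : Family d :=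
  fun n z => if h : n ≤ N then
      ∫ y : Config d (N - n), density ε β ρ N t
        fun i => Fin.append z y (Fin.cast (Nat.add_sub_of_le h).symm i)
    else 0

/-- `chain ε N [(h₁, j₁), …, (h_m, j_m)] F n` is
`Q_{n,J₁}(h₁) Q_{J₁,J₂}(h₂) ⋯ Q_{J_{m-1},J_m}(h_m) F_{J_m}`, where `J_i = n + j₁ + ⋯ + j_i`. -/
def chain {d : ℕ} (ε : ℝ) (N : ℕ) : List (ℝ × ℕ) → Family d → Family d
  | [], F => F
  | (h, j) :: l, F => fun n => Q ε N n j h (chain ε N l F)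

/-- The time `t_k^p = t - (h₁ + ⋯ + h_k)`. -/
def cutTime (t : ℝ) (h : ℕ → ℝ) (k : ℕ) : ℝ := t - ∑ i ∈ Finset.Icc 1 k, h i

/-- `∑_{s ≥ 2^k} Q_{n,n+s}(h_k) f_N^{(n+s)}(t_k^p)`, for every `n`. -/
def excess {d : ℕ} (ε β : ℝ) (ρ : Torus d → ℝ) (N : ℕ) [NeZero N] (t : ℝ) (h : ℕ → ℝ) (k : ℕ) :
    Family d :=
  fun n z => ∑' s : ℕ, Q ε N n (2 ^ k + s) (h k) (marginal ε β ρ N (cutTime t h k)) z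

/-- The pruned-out remainder `R^{[K]}(t)` of the cutting `h₁, …, h_K` (the other values of `h` are
not used): the sum over `1 ≤ k ≤ K` and over `0 ≤ j_i ≤ 2^i - 1`, `1 ≤ i ≤ k - 1`, of
`Q_{1,J₁}(h₁) ⋯ Q_{J_{k-2},J_{k-1}}(h_{k-1}) ∑_{s ≥ 2^k} Q_{J_{k-1},J_{k-1}+s}(h_k)
f_N^{(J_{k-1}+s)}(t_k^p)`. The index `i : Fin (k - 1)` stands for `i + 1`. -/
def remainder {d : ℕ} (ε β : ℝ) (ρ : Torus d → ℝ) (N : ℕ) [NeZero N] (K : ℕ) (t : ℝ)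
    (h : ℕ → ℝ) (z : Phase d) : ℝ :=
  ∑ k ∈ Finset.Icc 1 K,
    ∑ j ∈ Fintype.piFinset fun i : Fin (k - 1) => Finset.range (2 ^ ((i : ℕ) + 1)),
      chain ε N (List.ofFn fun i : Fin (k - 1) => (h ((i : ℕ) + 1), j i))
        (excess ε β ρ N t h k) 1 fun _ => z

end HardSphere

end

open scoped RealInnerProductSpace ENNReal
open MeasureTheory

noncomputable section

namespace HardSphere

/-! All bounds are pointwise, of the form `A * weight b`. The dynamics conserves energy, so
transport preserves them, and f_N(t) stays below ‖ρ‖ times the Gibbs density at all times. Since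
Z_{N-n}/Z_N ≤ D^n, the marginals are at most ‖ρ‖ D^n times a Gaussian, uniformly in t and ε
(`exists_abs_marginal_le`).

A collision operator costs a sum of speeds, which is paid for with Gaussian decay: giving up β/(2r²)
of the inverse temperature costs a factor r per collision. A term of the remainder has at most K
operators Q, and β/2 of decay is available in all, hence r = √K; then s collisions in a time h
contribute (C√K h)^s e^{n+s} (`abs_Q_le`). Before step k there are at most 2^k particles, so the
exponentials accumulate to e^{O(2^k)} (`abs_chain_le`). The 2^k collisions of the excess dominate
this and the at most 2^{2^k} choices of the j_i, and the k-th term is of order (C'√K h_k)^{2^k}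
(`abs_remainder_le`).

With L = K^{1-α}, it is therefore enough that √K h_k be at most a small multiple of exp(-2^{K-L-k}),
whose power 2^k is exp(-2^{K-L}). The last L or so of these bounds are of order one, so the h_k may
add up to a multiple of L/√K = K^{1/2-α}. -/

/-! ### Energy conservation and transport. -/

/-- Twice the kinetic energy of a configuration. -/
def energy {d n : ℕ} (z : Config d n) : ℝ := ∑ i, ‖(z i).2‖ ^ 2

theorem energy_nonneg {d n : ℕ} (z : Config d n) : 0 ≤ energy z :=
  Finset.sum_nonneg fun _ _ => sq_nonneg _

theorem energy_snoc {d n : ℕ} (z : Config d n) (w : Phase d) :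
    energy (Fin.snoc (α := fun _ => Phase d) z w : Config d (n + 1)) = energy z + ‖w.2‖ ^ 2 := by
  simp [energy, Fin.sum_univ_castSucc]

theorem energy_free {d n : ℕ} (s : ℝ) (z : Config d n) : energy (free s z) = energy z := rfl

theorem energy_scatter {d n : ℕ} {ε : ℝ} (hε : 0 < ε) {z : Config d n} {i j : Fin n}
    (h : Colliding ε z i j) : energy (scatter ε z i j) = energy z := by
  obtain ⟨hij, hd, -, -⟩ := h
  have key : ∑ k, (‖(scatter ε z i j k).2‖ ^ 2 - ‖(z k).2‖ ^ 2) = 0 := by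
    rw [Finset.sum_eq_add i j hij]
    · simp only [scatter, Function.update_self, Function.update_of_ne hij]
      set r := disp (z i).1 (z j).1 with hr
      have hrn : ‖r‖ = ε := hd
      set p := ⟪(z i).2 - (z j).2, r⟫ with hp
      have h1 : ⟪(z i).2, r⟫ - ⟪(z j).2, r⟫ = p := by rw [hp, inner_sub_left]
      rw [norm_sub_sq_real, norm_add_sq_real, norm_smul, inner_smul_right, inner_smul_right, hrn,
        mul_pow, Real.norm_eq_abs, sq_abs]
      have h2 : ⟪(z i).2, r⟫ = p + ⟪(z j).2, r⟫ := by linarith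
      rw [h2]
      field_simp
      ring
    · rintro k - ⟨hki, hkj⟩
      simp [scatter, Function.update_of_ne hki, Function.update_of_ne hkj]
    · simp
    · simp
  rw [Finset.sum_sub_distrib] at key
  exact sub_eq_zero.1 key

theorem Evolves.energy_eq {d n : ℕ} {ε : ℝ} (hε : 0 < ε) {z z' : Config d n} {τ : ℝ}
    (h : Evolves ε z τ z') : energy z = energy z' := by
  induction h with
  | free z τ hτ hdom => exact (energy_free τ z).symm
  | collision z τ₁ τ₂ z' i j hτ hdom hcoll hnext ih =>
    rw [← ih, energy_scatter hε hcoll, energy_free]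

theorem Evolves.mem_domain {d n : ℕ} {ε : ℝ} {z z' : Config d n} {τ : ℝ}
    (h : Evolves ε z τ z') : z' ∈ domain d ε n := by
  induction h with
  | free z τ hτ hdom => exact hdom τ ⟨hτ, le_rfl⟩
  | collision z τ₁ τ₂ z' i j hτ hdom hcoll hnext ih => exact ih

/-- The maximum principle for the transport operator, for bounds depending on the energy. -/
theorem abs_Θ_le_indicator {d n : ℕ} {ε : ℝ} (hε : 0 < ε) (t : ℝ) {f : Config d n → ℝ} {G : ℝ → ℝ}
    (hf : ∀ z, |f z| ≤ G (energy z)) (z : Config d n) :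
    |Θ ε n t f z| ≤ (domain d ε n).indicator (fun z => G (energy z)) z := by
  unfold Θ
  split_ifs with h
  -- Every preimage has the energy of `z`, so the one chosen does not matter and no uniqueness of
  -- trajectories is needed.
  · rw [Set.indicator_of_mem h.choose_spec.mem_domain, ← h.choose_spec.energy_eq hε]
    exact hf _
  · rw [abs_zero]
    exact Set.indicator_nonneg (fun z _ => (abs_nonneg _).trans (hf z)) z

theorem abs_Θ_le {d n : ℕ} {ε : ℝ} (hε : 0 < ε) (t : ℝ) {f : Config d n → ℝ} {G : ℝ → ℝ}
    (hf : ∀ z, |f z| ≤ G (energy z)) (z : Config d n) : |Θ ε n t f z| ≤ G (energy z) :=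
  (abs_Θ_le_indicator hε t hf z).trans
    (Set.indicator_le_self' (fun z _ => (abs_nonneg _).trans (hf z)) z)

theorem Θ_zero {d n : ℕ} (ε t : ℝ) : Θ ε n t (0 : Config d n → ℝ) = 0 := by
  ext z
  simp [Θ]

theorem C_zero {d : ℕ} (ε : ℝ) (N n : ℕ) : C ε N n (0 : Config d (n + 1) → ℝ) = 0 := by
  ext z
  simp [C]

/-- Disposes of the terms with more than N particles, to which the collision estimates, stated for
at most N particles, do not apply. -/
theorem Q_eq_zero {d : ℕ} (ε : ℝ) (N : ℕ) {F : Family d} (s n : ℕ) (t : ℝ)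
    (hF : F (n + s) = 0) : Q ε N n s t F = 0 := by
  induction s generalizing n t with
  | zero =>
    rw [Q]
    rw [add_zero] at hF
    rw [hF, Θ_zero]
  | succ s ih =>
    ext z
    have h : ∀ t, Q ε N (n + 1) s t F = 0 := fun t => ih (n + 1) t (by
      rw [show n + 1 + s = n + (s + 1) by omega]; exact hF)
    simp [Q, h, C_zero, Θ_zero]

/-! ### Gaussian weights and the collision operator. -/

/-- The weight `exp (-b E)`, where `E` is the kinetic energy. -/
def weight {d n : ℕ} (b : ℝ) (z : Config d n) : ℝ := Real.exp (-(b / 2) * energy z)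

theorem weight_pos {d n : ℕ} (b : ℝ) (z : Config d n) : 0 < weight b z := Real.exp_pos _

theorem weight_anti {d n : ℕ} {b b' : ℝ} (h : b' ≤ b) (z : Config d n) :
    weight b z ≤ weight b' z := by
  unfold weight
  gcongr
  exact energy_nonneg z

theorem weight_le_one {d n : ℕ} {b : ℝ} (h : 0 ≤ b) (z : Config d n) : weight b z ≤ 1 := by
  unfold weight
  rw [Real.exp_le_one_iff]
  nlinarith [energy_nonneg z]

theorem integral_exp_neg_mul_sq_pos {d : ℕ} {a : ℝ} (ha : 0 < a) :
    0 < ∫ v : Vel d, Real.exp (-a * ‖v‖ ^ 2) := by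
  rw [GaussianFourier.integral_rexp_neg_mul_sq_norm ha]
  positivity

theorem integrable_exp_neg_mul_sq {d : ℕ} {a : ℝ} (ha : 0 < a) :
    Integrable fun v : Vel d => Real.exp (-a * ‖v‖ ^ 2) := by
  -- A non-integrable function has integral 0 by convention, but this integral is positive.
  by_contra h
  exact (integral_exp_neg_mul_sq_pos (d := d) ha).ne' (integral_undef h)

theorem integrable_norm_mul_exp_neg_mul_sq {d : ℕ} {a : ℝ} (ha : 0 < a) :
    Integrable fun v : Vel d => ‖v‖ * Real.exp (-a * ‖v‖ ^ 2) := by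
  refine ((integrable_exp_neg_mul_sq (d := d) (a := a / 2) (by positivity)).const_mul
    (1 + 2 / a)).mono' (by fun_prop) (.of_forall fun v => ?_)
  rw [Real.norm_eq_abs, abs_of_nonneg (by positivity)]
  have h1 : ‖v‖ ≤ (1 + 2 / a) * Real.exp (a / 2 * ‖v‖ ^ 2) := by
    have h2 := Real.add_one_le_exp (a / 2 * ‖v‖ ^ 2)
    have h3 : ‖v‖ ≤ 1 + ‖v‖ ^ 2 := by nlinarith [sq_nonneg (‖v‖ - 1)]
    have h4 : 1 + ‖v‖ ^ 2 ≤ (1 + 2 / a) * (a / 2 * ‖v‖ ^ 2 + 1) := by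
      have : (1 + 2 / a) * (a / 2 * ‖v‖ ^ 2 + 1) =
        1 + ‖v‖ ^ 2 + (a / 2 * ‖v‖ ^ 2 + 2 / a) := by field_simp; ring
      rw [this]
      have : 0 ≤ a / 2 * ‖v‖ ^ 2 + 2 / a := by positivity
      linarith
    have h5 : (1 + 2 / a) * (a / 2 * ‖v‖ ^ 2 + 1) ≤ (1 + 2 / a) * Real.exp (a / 2 * ‖v‖ ^ 2) := by
      gcongr
    linarith
  calc ‖v‖ * Real.exp (-a * ‖v‖ ^ 2)
      ≤ (1 + 2 / a) * Real.exp (a / 2 * ‖v‖ ^ 2) * Real.exp (-a * ‖v‖ ^ 2) := by gcongr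
    _ = (1 + 2 / a) * Real.exp (-(a / 2) * ‖v‖ ^ 2) := by
      rw [mul_assoc, ← Real.exp_add]
      ring_nf

/-- The constant of the first estimate of the collision operator. -/
def collisionConst (d : ℕ) (β : ℝ) : ℝ :=
  (volume : Measure (Vel d)).toSphere.real Set.univ *
    ((∫ v : Vel d, Real.exp (-(β / 4) * ‖v‖ ^ 2)) +
      ∫ v : Vel d, ‖v‖ * Real.exp (-(β / 4) * ‖v‖ ^ 2))

theorem collisionConst_nonneg (d : ℕ) (β : ℝ) : 0 ≤ collisionConst d β := by
  unfold collisionConst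
  have h1 : 0 ≤ ∫ v : Vel d, Real.exp (-(β / 4) * ‖v‖ ^ 2) :=
    integral_nonneg fun v => (Real.exp_pos _).le
  have h2 : 0 ≤ ∫ v : Vel d, ‖v‖ * Real.exp (-(β / 4) * ‖v‖ ^ 2) :=
    integral_nonneg fun v => mul_nonneg (norm_nonneg _) (Real.exp_pos _).le
  positivity

/-- No cancellation between gain and loss is used: the kernel is at most |v| + |v_i|. Since b ≥ β/2,
the new particle carries at least the decay exp(-β|v|²/4), which makes the constant independent of
b. -/
theorem abs_C_le {d : ℕ} {β : ℝ} (hβ : 0 < β) {ε : ℝ} (hε : 0 < ε) {N n : ℕ}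
    (hN : (N : ℝ) * ε ^ (d - 1) = 1) (hn : n ≤ N) {A b : ℝ} (hA : 0 ≤ A) (hb : β / 2 ≤ b)
    {f : Config d (n + 1) → ℝ} (hf : ∀ z, |f z| ≤ A * weight b z) (z : Config d n) :
    |C ε N n f z| ≤ A * collisionConst d β * (n + ∑ i, ‖(z i).2‖) * weight b z := by
  set S := (volume : Measure (Vel d)).toSphere.real Set.univ with hS
  set I₀ := ∫ v : Vel d, Real.exp (-(β / 4) * ‖v‖ ^ 2) with hI₀
  set I₁ := ∫ v : Vel d, ‖v‖ * Real.exp (-(β / 4) * ‖v‖ ^ 2) with hI₁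
  have h0 : 0 ≤ I₀ := integral_nonneg fun v => (Real.exp_pos _).le
  have h1 : 0 ≤ I₁ := integral_nonneg fun v => mul_nonneg (norm_nonneg _) (Real.exp_pos _).le
  have hS0 : 0 ≤ S := measureReal_nonneg
  have hβ4 : 0 < β / 4 := by positivity
  have hpre : |((N : ℝ) - n) * ε ^ (d - 1)| ≤ 1 := by
    have hn' : (n : ℝ) ≤ N := by exact_mod_cast hn
    have hε' : 0 < ε ^ (d - 1) := by positivity
    rw [abs_of_nonneg (mul_nonneg (by linarith) hε'.le)]
    have : (0 : ℝ) ≤ n * ε ^ (d - 1) := by positivity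
    linarith
  have hterm : ∀ i : Fin n, |∫ v : Vel d, ∫ ω : Metric.sphere (0 : Vel d) 1,
      ⟪(ω : Vel d), v - (z i).2⟫ *
        f (Fin.snoc (α := fun _ => Phase d) z ((z i).1 + toTorus (ε • (ω : Vel d)), v))
      ∂(volume : Measure (Vel d)).toSphere| ≤ A * weight b z * S * (I₁ + ‖(z i).2‖ * I₀) := by
    intro i
    have hint : Integrable fun v : Vel d => A * weight b z * S *
        (‖v‖ * Real.exp (-(β / 4) * ‖v‖ ^ 2) + ‖(z i).2‖ * Real.exp (-(β / 4) * ‖v‖ ^ 2)) :=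
      ((integrable_norm_mul_exp_neg_mul_sq hβ4).add
        ((integrable_exp_neg_mul_sq hβ4).const_mul _)).const_mul _
    -- Only the majorant has to be integrable, so the measurability of `f` never comes up.
    have := norm_integral_le_of_norm_le (f := fun v : Vel d => ∫ ω : Metric.sphere (0 : Vel d) 1,
      ⟪(ω : Vel d), v - (z i).2⟫ *
        f (Fin.snoc (α := fun _ => Phase d) z ((z i).1 + toTorus (ε • (ω : Vel d)), v))
      ∂(volume : Measure (Vel d)).toSphere) hint (.of_forall fun v => ?_)
    · rw [integral_const_mul, integral_add (integrable_norm_mul_exp_neg_mul_sq hβ4)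
        ((integrable_exp_neg_mul_sq hβ4).const_mul _), integral_const_mul] at this
      exact this
    · refine (norm_integral_le_of_norm_le_const (C := (‖v‖ + ‖(z i).2‖) *
        (A * (weight b z * Real.exp (-(β / 4) * ‖v‖ ^ 2)))) (.of_forall fun ω => ?_)).trans_eq ?_
      · rw [norm_mul]
        have hω : ‖(ω : Vel d)‖ = 1 := by simp
        gcongr
        · refine (norm_inner_le_norm _ _).trans ?_
          rw [hω, one_mul]
          exact norm_sub_le _ _
        · refine (hf _).trans ?_
          gcongr
          rw [weight, energy_snoc, mul_add, Real.exp_add]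
          exact mul_le_mul_of_nonneg_left (Real.exp_le_exp.2
            (mul_le_mul_of_nonneg_right (by linarith) (sq_nonneg _))) (Real.exp_pos _).le
      · rw [← hS]; ring
  have hC : |C ε N n f z| ≤ ∑ i : Fin n, A * weight b z * S * (I₁ + ‖(z i).2‖ * I₀) := by
    rw [C, abs_mul]
    refine (mul_le_of_le_one_left (abs_nonneg _) hpre).trans ?_
    exact (Finset.abs_sum_le_sum_abs _ _).trans (Finset.sum_le_sum fun i _ => hterm i)
  refine hC.trans ?_
  rw [← Finset.mul_sum, Finset.sum_add_distrib, ← Finset.sum_mul, Finset.sum_const,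
    Finset.card_univ, Fintype.card_fin, nsmul_eq_mul, collisionConst, ← hS, ← hI₀, ← hI₁]
  have hw := (weight_pos b z).le
  have hV : 0 ≤ ∑ i, ‖(z i).2‖ := Finset.sum_nonneg fun _ _ => norm_nonneg _
  have h3 : 0 ≤ A * weight b z * S * (n * I₀ + (∑ i, ‖(z i).2‖) * I₁) := by positivity
  linear_combination h3

/-- The constant of the estimate of the collision operator with loss of weight. -/
def lossConst (d : ℕ) (β : ℝ) : ℝ := collisionConst d β * (4 + 4 / β) + 1

theorem lossConst_pos (d : ℕ) {β : ℝ} (hβ : 0 < β) : 0 < lossConst d β := by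
  have := collisionConst_nonneg d β
  unfold lossConst
  positivity

/-- Young's inequality |v| ≤ r/2 + |v|²/(2r) turns the speeds into energy, and y ≤ e^y pays for the
energy with the decay given up. The loss is proportional to 1/s so that s collisions lose β/(2r²)
altogether. -/
theorem abs_C_le_of_loss {d : ℕ} {β : ℝ} (hβ : 0 < β) {ε : ℝ} (hε : 0 < ε) {N n s m : ℕ}
    (hN : (N : ℝ) * ε ^ (d - 1) = 1) (hm : m ≤ N) (hn : n ≤ m) (hs : 0 < s) (hsm : s ≤ m)
    {A b r : ℝ} (hA : 0 ≤ A) (hb : β / 2 ≤ b) (hr : 1 ≤ r)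
    {f : Config d (n + 1) → ℝ} (hf : ∀ z, |f z| ≤ A * weight b z) (z : Config d n) :
    |C ε N n f z| ≤
      A * (lossConst d β * r * m) * weight (b - β / (2 * r ^ 2 * s)) z := by
  have hr0 : 0 < r := by linarith
  have hs' : (0 : ℝ) < s := by exact_mod_cast hs
  have hsm' : (s : ℝ) ≤ m := by exact_mod_cast hsm
  have hnm' : (n : ℝ) ≤ m := by exact_mod_cast hn
  have hκ := collisionConst_nonneg d β
  set y := β / (2 * r ^ 2 * s) / 2 * energy z with hy
  have hw : weight (b - β / (2 * r ^ 2 * s)) z = Real.exp y * weight b z := by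
    rw [weight, weight, ← Real.exp_add, hy]
    ring_nf
  have hE := energy_nonneg z
  have hy0 : 0 ≤ y := by positivity
  have hexp : 1 ≤ Real.exp y := Real.one_le_exp hy0
  have hyexp : y ≤ Real.exp y := by linarith [Real.add_one_le_exp y]
  have hsum : ∑ i, ‖(z i).2‖ ≤ n * (r / 2) + energy z / (2 * r) := by
    have : ∀ i, ‖(z i).2‖ ≤ r / 2 + ‖(z i).2‖ ^ 2 / (2 * r) := fun i => by
      have : r / 2 + ‖(z i).2‖ ^ 2 / (2 * r) - ‖(z i).2‖ = (‖(z i).2‖ - r) ^ 2 / (2 * r) := by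
        field_simp; ring
      have h2 : 0 ≤ (‖(z i).2‖ - r) ^ 2 / (2 * r) := by positivity
      linarith
    refine (Finset.sum_le_sum fun i _ => this i).trans_eq ?_
    rw [Finset.sum_add_distrib, Finset.sum_const, Finset.card_univ, Fintype.card_fin,
      nsmul_eq_mul, ← Finset.sum_div, energy]
  have hEy : energy z / (2 * r) = 2 * r * s / β * y := by
    rw [hy]; field_simp
  have htot : n + ∑ i, ‖(z i).2‖ ≤ (4 + 4 / β) * r * m * Real.exp y := by
    have h1 : energy z / (2 * r) ≤ 2 * r * m / β * Real.exp y := by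
      rw [hEy]; gcongr
    have h2 : (n : ℝ) + n * (r / 2) ≤ 2 * r * m * Real.exp y := by
      calc (n : ℝ) + n * (r / 2) = n * (1 + r / 2) := by ring
        _ ≤ m * (2 * r) := by gcongr; linarith
        _ ≤ m * (2 * r) * Real.exp y := le_mul_of_one_le_right (by positivity) hexp
        _ = _ := by ring
    have h3 : 0 ≤ (2 * r * m + 2 * r * m / β) * Real.exp y := by positivity
    calc n + ∑ i, ‖(z i).2‖ ≤ (2 * r * m + 2 * r * m / β) * Real.exp y := by linarith
      _ ≤ (2 * r * m + 2 * r * m / β) * Real.exp y + (2 * r * m + 2 * r * m / β) * Real.exp y := by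
        linarith
      _ = _ := by ring
  refine (abs_C_le hβ hε hN (hn.trans hm) hA hb hf z).trans ?_
  rw [hw]
  have hwp := (weight_pos b z).le
  calc A * collisionConst d β * (n + ∑ i, ‖(z i).2‖) * weight b z
      ≤ A * collisionConst d β * ((4 + 4 / β) * r * m * Real.exp y) * weight b z := by gcongr
    _ = A * ((collisionConst d β * (4 + 4 / β)) * r * m) * (Real.exp y * weight b z) := by ring
    _ ≤ A * (lossConst d β * r * m) * (Real.exp y * weight b z) := by
      gcongr
      rw [lossConst]; linarith

/-! ### Successive collisions. -/

/-- The loss per collision is fixed by `p`, the total number of collisions in the application, while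
`s` runs in the induction. The final number `m` of particles bounds all intermediate ones, and the
ordered times give t^s/s!. -/
theorem abs_Q_le_factorial {d : ℕ} {β : ℝ} (hβ : 0 < β) {ε : ℝ} (hε : 0 < ε) {N m p : ℕ}
    (hN : (N : ℝ) * ε ^ (d - 1) = 1) (hm : m ≤ N) (hp : 0 < p) (hpm : p ≤ m)
    {A b r : ℝ} (hA : 0 ≤ A) (hr : 1 ≤ r) {F : Family d}
    (hF : ∀ z, |F m z| ≤ A * weight b z) (s : ℕ) :
    ∀ (n : ℕ) (t : ℝ), n + s = m → β / 2 + s * (β / (2 * r ^ 2 * p)) ≤ b → 0 ≤ t → ∀ z,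
      |Q ε N n s t F z| ≤ A * (lossConst d β * r * m) ^ s * (t ^ s / s.factorial) *
        weight (b - s * (β / (2 * r ^ 2 * p))) z := by
  set l := β / (2 * r ^ 2 * p) with hl
  have hl0 : 0 ≤ l := by positivity
  have hκ := lossConst_pos d hβ
  induction s with
  | zero =>
    intro n t hn hb ht z
    subst hn
    have := abs_Θ_le hε t (G := fun e => A * Real.exp (-(b / 2) * e)) hF z
    simpa [Q, weight] using this
  | succ s ih =>
    intro n t hn hb ht z
    have hb' : β / 2 + s * l ≤ b := by push_cast at hb; nlinarith
    set G := lossConst d β * r * m with hG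
    have hG0 : 0 ≤ G := by positivity
    have hstep : ∀ t₁ : ℝ, 0 ≤ t₁ → |Θ ε n (t - t₁) (C ε N n (Q ε N (n + 1) s t₁ F)) z| ≤
        A * G ^ (s + 1) * (t₁ ^ s / s.factorial) * weight (b - (s + 1 : ℕ) * l) z := by
      intro t₁ ht₁
      refine abs_Θ_le hε _ (G := fun e => A * G ^ (s + 1) * (t₁ ^ s / s.factorial) *
        Real.exp (-((b - (s + 1 : ℕ) * l) / 2) * e)) (fun z => ?_) z
      have h1 := abs_C_le_of_loss hβ hε hN hm (n := n) (by omega) hp hpm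
        (A := A * G ^ s * (t₁ ^ s / s.factorial)) (by positivity) (b := b - s * l)
        (by linarith) hr (fun z => ih (n + 1) t₁ (by omega) hb' ht₁ z) z
      refine h1.trans_eq ?_
      rw [← hG, ← hl, weight]
      push_cast
      ring_nf
    rw [Q]
    have hcont : Continuous fun t₁ : ℝ =>
        A * G ^ (s + 1) * (t₁ ^ s / s.factorial) * weight (b - (s + 1 : ℕ) * l) z := by
      fun_prop
    refine (intervalIntegral.norm_integral_le_of_norm_le
      (f := fun t₁ => Θ ε n (t - t₁) (C ε N n (Q ε N (n + 1) s t₁ F)) z) ht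
      (.of_forall fun t₁ h₁ => hstep t₁ h₁.1.le) (hcont.intervalIntegrable 0 t)).trans_eq ?_
    rw [intervalIntegral.integral_mul_const, intervalIntegral.integral_const_mul,
      intervalIntegral.integral_div, integral_pow, Nat.factorial_succ]
    push_cast
    field_simp
    simp

/-- The estimate of the successive-collision operators, with a loss `β / (2 r²)` of weight. -/
theorem abs_Q_le {d : ℕ} {β : ℝ} (hβ : 0 < β) {ε : ℝ} (hε : 0 < ε) {N : ℕ}
    (hN : (N : ℝ) * ε ^ (d - 1) = 1) {A b r t : ℝ} (hA : 0 ≤ A) (hr : 1 ≤ r) (ht : 0 ≤ t)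
    {F : Family d} {n s : ℕ} (hns : n + s ≤ N) (hb : β / 2 + β / (2 * r ^ 2) ≤ b)
    (hF : ∀ z, |F (n + s) z| ≤ A * weight b z) (z : Config d n) :
    |Q ε N n s t F z| ≤ A * (lossConst d β * r * t) ^ s * Real.exp (n + s) *
      weight (b - β / (2 * r ^ 2)) z := by
  have hκ := lossConst_pos d hβ
  have hr0 : 0 < r := by linarith
  -- The loss is divided among s collisions, so s = 0 stands apart.
  rcases Nat.eq_zero_or_pos s with rfl | hs
  · have h1 := abs_Θ_le hε t (G := fun e => A * Real.exp (-(b / 2) * e)) hF z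
    have h2 : weight b z ≤ weight (b - β / (2 * r ^ 2)) z :=
      weight_anti (by have : 0 ≤ β / (2 * r ^ 2) := by positivity
                      linarith) z
    have h3 : 1 ≤ Real.exp ((n : ℝ) + (0 : ℕ)) := Real.one_le_exp (by positivity)
    have hw := (weight_pos b z).le
    calc |Q ε N n 0 t F z| ≤ A * weight b z := h1
      _ ≤ A * Real.exp (n + (0 : ℕ)) * weight (b - β / (2 * r ^ 2)) z := by
        refine mul_le_mul (le_mul_of_one_le_right hA h3) h2 hw (by positivity)
      _ = _ := by simp
  · have hs' : (s : ℝ) ≠ 0 := by positivity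
    have hl : s * (β / (2 * r ^ 2 * s)) = β / (2 * r ^ 2) := by field_simp
    have h := abs_Q_le_factorial hβ hε hN hns hs (by omega) hA hr hF s n t rfl
      (by rw [hl]; exact hb) ht z
    rw [hl] at h
    refine h.trans ?_
    have hw := (weight_pos (b - β / (2 * r ^ 2)) z).le
    refine mul_le_mul_of_nonneg_right ?_ hw
    calc A * (lossConst d β * r * (n + s : ℕ)) ^ s * (t ^ s / s.factorial)
        = A * (lossConst d β * r * t) ^ s * (((n : ℝ) + s) ^ s / s.factorial) := by
          push_cast
          rw [mul_pow, mul_pow _ t]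
          ring
      _ ≤ _ := by
        gcongr
        -- The 1/s! of the time simplex compensates the power (n+s)^s from the collision operators.
        exact Real.pow_div_factorial_le_exp _ (by positivity) _

/-! ### Geometry of the torus and of the hard-sphere domain. -/

instance isProbabilityMeasure_torus (d : ℕ) :
    IsProbabilityMeasure (volume : Measure (Torus d)) where
  measure_univ := by
    rw [← Set.pi_univ Set.univ, volume_pi_pi]
    simp [AddCircle.measure_univ]

theorem abs_equivIoc (x : UnitAddCircle) :
    |(AddCircle.equivIoc (1 : ℝ) (-1 / 2) x : ℝ)| = ‖x‖ := by
  obtain ⟨h1, h2⟩ := (AddCircle.equivIoc (1 : ℝ) (-1 / 2) x).2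
  have h : ((AddCircle.equivIoc (1 : ℝ) (-1 / 2) x : ℝ) : UnitAddCircle) = x :=
    AddCircle.coe_equivIoc
  rw [← (AddCircle.norm_coe_eq_abs_iff (1 : ℝ) one_ne_zero).2, h]
  rw [abs_one, abs_le]
  constructor <;> linarith

/-- The representative `disp` jumps at the cut, but its norm does not; this form gives the
continuity of the distance, hence the measurability of the domain. -/
theorem torusDist_eq {d : ℕ} (x y : Torus d) : torusDist x y = √(∑ k, ‖x k - y k‖ ^ 2) := by
  rw [torusDist, EuclideanSpace.norm_eq]
  congr 1
  refine Finset.sum_congr rfl fun k _ => ?_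
  rw [← abs_equivIoc, disp, Real.norm_eq_abs]

theorem torusDist_comm {d : ℕ} (x y : Torus d) : torusDist x y = torusDist y x := by
  simp only [torusDist_eq, norm_sub_rev]

theorem continuous_torusDist {d n : ℕ} (i j : Fin n) :
    Continuous fun z : Config d n => torusDist (z i).1 (z j).1 := by
  simp only [torusDist_eq]
  fun_prop

theorem isClosed_domain (d : ℕ) (ε : ℝ) (n : ℕ) : IsClosed (domain d ε n) := by
  simp only [domain, Set.ofPred_forall]
  exact isClosed_iInter fun i => isClosed_iInter fun j => isClosed_iInter fun _ =>
    isClosed_le continuous_const (continuous_torusDist i j)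

theorem cons_mem_domain_iff {d n : ℕ} {ε : ℝ} (w : Phase d) (z : Config d n) :
    (Fin.cons w z : Config d (n + 1)) ∈ domain d ε (n + 1) ↔
      z ∈ domain d ε n ∧ ∀ i, ε ≤ torusDist w.1 (z i).1 := by
  constructor
  · intro h
    refine ⟨fun i j hij => ?_, fun i => ?_⟩
    · simpa using h i.succ j.succ (by simpa using hij)
    · simpa using h 0 i.succ (Fin.succ_ne_zero i).symm
  · rintro ⟨h1, h2⟩ i j hij
    induction i using Fin.cases with
    | zero =>
      induction j using Fin.cases with
      | zero => exact absurd rfl hij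
      | succ j => simpa using h2 j
    | succ i =>
      induction j using Fin.cases with
      | zero => simpa [torusDist_comm] using h2 i
      | succ j => simpa using h1 i j (by simpa using hij)

/-! ### Maxwell and Gibbs weights. -/

theorem maxwell_nonneg {d : ℕ} {β : ℝ} (hβ : 0 < β) (v : Vel d) : 0 ≤ maxwell β v := by
  unfold maxwell
  positivity

theorem integral_maxwell {d : ℕ} {β : ℝ} (hβ : 0 < β) : ∫ v : Vel d, maxwell β v = 1 := by
  simp only [maxwell]
  rw [integral_const_mul, GaussianFourier.integral_rexp_neg_mul_sq_norm (by positivity),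
    finrank_euclideanSpace, Fintype.card_fin, ← Real.mul_rpow (by positivity) (by positivity)]
  have : β / (2 * Real.pi) * (Real.pi / (β / 2)) = 1 := by
    field_simp
  rw [this, Real.one_rpow]

theorem integrable_maxwell {d : ℕ} {β : ℝ} (hβ : 0 < β) :
    Integrable fun v : Vel d => maxwell β v :=
  (integrable_exp_neg_mul_sq (by positivity)).const_mul _

theorem integrable_maxwell_snd {d : ℕ} {β : ℝ} (hβ : 0 < β) :
    Integrable fun w : Phase d => maxwell β w.2 := by
  have := (integrable_const (μ := (volume : Measure (Torus d))) (1 : ℝ)).mul_prod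
    (integrable_maxwell (d := d) hβ)
  simp only [one_mul] at this
  exact this

theorem gibbs_nonneg {d n : ℕ} {ε β : ℝ} (hβ : 0 < β) (z : Config d n) : 0 ≤ gibbs ε β n z :=
  Set.indicator_nonneg (fun _ _ => Finset.prod_nonneg fun _ _ => maxwell_nonneg hβ _) z

theorem integrable_gibbs {d n : ℕ} {ε β : ℝ} (hβ : 0 < β) :
    Integrable (gibbs (d := d) ε β n) :=
  (@Integrable.fintype_prod ℝ (Fin n) _ _ (Phase d) (fun _ w => maxwell β w.2) _
    (fun _ => volume) (fun _ => inferInstance) fun _ => integrable_maxwell_snd hβ).indicator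
    (isClosed_domain d ε n).measurableSet

theorem partitionZ_nonneg {d : ℕ} {ε β : ℝ} (hβ : 0 < β) (n : ℕ) : 0 ≤ partitionZ d ε β n :=
  integral_nonneg fun z => gibbs_nonneg hβ z

theorem prod_maxwell {d n : ℕ} (β : ℝ) (z : Config d n) :
    ∏ i, maxwell β (z i).2 = ((β / (2 * Real.pi)) ^ ((d : ℝ) / 2)) ^ n * weight β z := by
  simp only [maxwell, weight, energy]
  rw [Finset.prod_mul_distrib, ← Real.exp_sum, Finset.mul_sum]
  simp

/-! ### Excluded volume and ratios of partition functions. -/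

theorem measureReal_torusDist_lt {d : ℕ} {ε : ℝ} (hε : 0 < ε) (y : Torus d) :
    volume.real {x : Torus d | torusDist x y < ε} ≤ (2 * ε) ^ d := by
  have hsub : {x : Torus d | torusDist x y < ε} ⊆ Metric.closedBall y ε := by
    intro x hx
    rw [Metric.mem_closedBall, dist_pi_le_iff hε.le]
    intro k
    rw [dist_eq_norm]
    have hx' : torusDist x y < ε := hx
    rw [torusDist_eq] at hx'
    refine le_trans ?_ hx'.le
    apply Real.le_sqrt_of_sq_le
    exact Finset.single_le_sum (f := fun k => ‖x k - y k‖ ^ 2) (fun _ _ => sq_nonneg _)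
      (Finset.mem_univ k)
  have hvol : volume (Metric.closedBall y ε) ≤ ENNReal.ofReal ((2 * ε) ^ d) := by
    rw [closedBall_pi _ hε.le, volume_pi_pi]
    calc ∏ k, volume (Metric.closedBall (y k) ε) ≤ ∏ _k : Fin d, ENNReal.ofReal (2 * ε) := by
          refine Finset.prod_le_prod' fun k _ => ?_
          rw [AddCircle.volume_closedBall]
          exact ENNReal.ofReal_le_ofReal (min_le_right _ _)
      _ = _ := by
        rw [Finset.prod_const, Finset.card_univ, Fintype.card_fin,
          ENNReal.ofReal_pow (by positivity)]
  exact ENNReal.toReal_le_of_le_ofReal (by positivity) ((measure_mono hsub).trans hvol)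

theorem measurableSet_torusDist_lt {d : ℕ} (ε : ℝ) (y : Torus d) :
    MeasurableSet {x : Torus d | torusDist x y < ε} := by
  refine (isOpen_lt ?_ continuous_const).measurableSet
  simp only [torusDist_eq]
  fun_prop

theorem measurableEquiv_cons_apply {d n : ℕ} (w : Phase d) (z : Config d n) :
    (MeasurableEquiv.piFinSuccAbove (fun _ : Fin (n + 1) => Phase d) 0).symm (w, z) =
      (Fin.cons w z : Config d (n + 1)) :=
  Fin.insertNth_zero' w z

instance sigmaFinite_config (d n : ℕ) : SigmaFinite (volume : Measure (Config d n)) :=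
  @Measure.pi.sigmaFinite (Fin n) (fun _ => Phase d) _ _ (fun _ => volume) fun _ => inferInstance

theorem partitionZ_succ {d n : ℕ} {ε β : ℝ} (hβ : 0 < β) :
    partitionZ d ε β (n + 1) =
      ∫ z : Config d n, ∫ w : Phase d, gibbs ε β (n + 1) (Fin.cons w z : Config d (n + 1)) := by
  have hmp := (@volume_preserving_piFinSuccAbove n (fun _ => Phase d) _
    (fun _ => inferInstance) 0).symm
  have hint := (hmp.integrable_comp_emb (MeasurableEquiv.measurableEmbedding _)).2
    (integrable_gibbs (d := d) (n := n + 1) (ε := ε) hβ)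
  rw [partitionZ, ← hmp.integral_comp (MeasurableEquiv.measurableEmbedding _)]
  have h := @integral_prod_symm (Phase d) (Config d n) ℝ _ _ volume volume _ inferInstance _
    inferInstance _ hint
  simp only [Function.comp_def, measurableEquiv_cons_apply] at h
  exact h

theorem integrable_integral_gibbs_cons {d n : ℕ} {ε β : ℝ} (hβ : 0 < β) :
    Integrable fun z : Config d n =>
      ∫ w : Phase d, gibbs ε β (n + 1) (Fin.cons w z : Config d (n + 1)) := by
  have hmp := (@volume_preserving_piFinSuccAbove n (fun _ => Phase d) _
    (fun _ => inferInstance) 0).symm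
  have hint := (hmp.integrable_comp_emb (MeasurableEquiv.measurableEmbedding _)).2
    (integrable_gibbs (d := d) (n := n + 1) (ε := ε) hβ)
  have h := @Integrable.integral_prod_right (Phase d) (Config d n) ℝ _ _ volume volume _
    inferInstance _ inferInstance _ hint
  simpa only [Function.comp_def, measurableEquiv_cons_apply] using h

/-- Each of the n particles forbids a volume at most (2ε)^d to a new one, whose velocity integrates
to 1. -/
theorem gibbs_mul_le_integral {d n : ℕ} {ε β : ℝ} (hε : 0 < ε) (hβ : 0 < β) (z : Config d n) :
    gibbs ε β n z * (1 - n * (2 * ε) ^ d) ≤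
      ∫ w : Phase d, gibbs ε β (n + 1) (Fin.cons w z : Config d (n + 1)) := by
  by_cases hz : z ∈ domain d ε n
  swap
  · rw [gibbs, Set.indicator_of_notMem hz, zero_mul]
    exact integral_nonneg fun w => gibbs_nonneg hβ _
  have hg : gibbs ε β n z = ∏ i, maxwell β (z i).2 := Set.indicator_of_mem hz _
  have hg0 := gibbs_nonneg (ε := ε) hβ z
  have hcons : ∀ w : Phase d, gibbs ε β (n + 1) (Fin.cons w z : Config d (n + 1)) =
      ({w : Phase d | ∀ i, ε ≤ torusDist w.1 (z i).1}).indicator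
        (fun w => gibbs ε β n z * maxwell β w.2) w := fun w => by
    by_cases hw : ∀ i, ε ≤ torusDist w.1 (z i).1
    · rw [Set.indicator_of_mem (show w ∈ {w : Phase d | ∀ i, ε ≤ torusDist w.1 (z i).1} from hw), gibbs,
        Set.indicator_of_mem ((cons_mem_domain_iff w z).2 ⟨hz, hw⟩), hg, Fin.prod_univ_succ]
      simp [mul_comm]
    · rw [Set.indicator_of_notMem (show w ∉ {w : Phase d | ∀ i, ε ≤ torusDist w.1 (z i).1} from hw), gibbs,
        Set.indicator_of_notMem fun h => hw ((cons_mem_domain_iff w z).1 h).2]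
  have hmeas : MeasurableSet {w : Phase d | ∀ i, ε ≤ torusDist w.1 (z i).1} := by
    rw [Set.ofPred_forall]
    refine MeasurableSet.iInter fun i => (isClosed_le continuous_const ?_).measurableSet
    simp only [torusDist_eq]
    fun_prop
  have hint : Integrable fun w : Phase d =>
      gibbs ε β (n + 1) (Fin.cons w z : Config d (n + 1)) := by
    simp only [hcons]
    exact ((integrable_maxwell_snd hβ).const_mul _).indicator hmeas
  -- By the union bound, φ lies below the indicator of the allowed positions; it may be negative
  -- where exclusion balls overlap.
  let φ : Torus d → ℝ := fun x =>
    1 - ∑ i, ({x : Torus d | torusDist x (z i).1 < ε}).indicator (fun _ => (1 : ℝ)) x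
  have hind : ∀ i, Integrable
      (({x : Torus d | torusDist x (z i).1 < ε}).indicator (fun _ => (1 : ℝ))) := fun i =>
    (integrable_const 1).indicator (measurableSet_torusDist_lt ε _)
  have hφ : Integrable φ :=
    (integrable_const 1).sub (integrable_finsetSum _ fun i _ => hind i)
  have hφint : 1 - n * (2 * ε) ^ d ≤ ∫ x, φ x := by
    simp only [φ]
    rw [integral_sub (integrable_const 1) (integrable_finsetSum _ fun i _ => hind i),
      integral_finsetSum _ fun i _ => hind i]
    have : ∑ i, ∫ x, ({x : Torus d | torusDist x (z i).1 < ε}).indicator (fun _ => (1 : ℝ)) x ≤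
        ∑ _i : Fin n, (2 * ε) ^ d := Finset.sum_le_sum fun i _ => by
      rw [integral_indicator_const _ (measurableSet_torusDist_lt ε _), smul_eq_mul, mul_one]
      exact measureReal_torusDist_lt hε _
    simp only [Finset.sum_const, Finset.card_univ, Fintype.card_fin, nsmul_eq_mul] at this
    rw [integral_const, probReal_univ, one_smul]
    exact sub_le_sub_left this 1
  have hprod : ∫ w : Phase d, φ w.1 * maxwell β w.2 = ∫ x, φ x := by
    have := integral_prod_mul (μ := (volume : Measure (Torus d)))
      (ν := (volume : Measure (Vel d))) φ (maxwell β)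
    rwa [integral_maxwell hβ, mul_one] at this
  calc gibbs ε β n z * (1 - n * (2 * ε) ^ d)
      ≤ gibbs ε β n z * ∫ w : Phase d, φ w.1 * maxwell β w.2 := by rw [hprod]; gcongr
    _ = ∫ w : Phase d, gibbs ε β n z * (φ w.1 * maxwell β w.2) := (integral_const_mul _ _).symm
    _ ≤ _ := by
      refine integral_mono ((hφ.mul_prod (integrable_maxwell hβ)).const_mul _) hint fun w => ?_
      simp only
      rw [hcons]
      have hM := maxwell_nonneg hβ w.2
      by_cases hw : ∀ i, ε ≤ torusDist w.1 (z i).1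
      · rw [Set.indicator_of_mem (show w ∈ {w : Phase d | ∀ i, ε ≤ torusDist w.1 (z i).1} from hw)]
        have : φ w.1 ≤ 1 := sub_le_self _
          (Finset.sum_nonneg fun i _ => Set.indicator_nonneg (fun _ _ => zero_le_one) _)
        exact mul_le_mul_of_nonneg_left (mul_le_of_le_one_left hM this) hg0
      · rw [Set.indicator_of_notMem (show w ∉ {w : Phase d | ∀ i, ε ≤ torusDist w.1 (z i).1} from hw)]
        push Not at hw
        obtain ⟨i, hi⟩ := hw
        have h1 : (1 : ℝ) ≤ ∑ i, ({x : Torus d | torusDist x (z i).1 < ε}).indicator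
            (fun _ => (1 : ℝ)) w.1 := by
          refine le_trans ?_ (Finset.single_le_sum
            (fun i _ => Set.indicator_nonneg (fun _ _ => zero_le_one) _) (Finset.mem_univ i))
          rw [Set.indicator_of_mem (show w.1 ∈ {x : Torus d | torusDist x (z i).1 < ε} from hi)]
        exact mul_nonpos_of_nonneg_of_nonpos hg0
          (mul_nonpos_of_nonpos_of_nonneg (by simp only [φ]; linarith) hM)

theorem partitionZ_mul_le_succ {d n : ℕ} {ε β : ℝ} (hε : 0 < ε) (hβ : 0 < β) :
    partitionZ d ε β n * (1 - n * (2 * ε) ^ d) ≤ partitionZ d ε β (n + 1) := by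
  rw [partitionZ_succ hβ, partitionZ, ← integral_mul_const]
  exact integral_mono ((integrable_gibbs hβ).mul_const _) (integrable_integral_gibbs_cons hβ)
    fun z => gibbs_mul_le_integral hε hβ z

theorem partitionZ_sub_le {d N : ℕ} {ε β : ℝ} (hε : 0 < ε) (hβ : 0 < β)
    (h : N * (2 * ε) ^ d ≤ 1 / 2) (n : ℕ) (hn : n ≤ N) :
    partitionZ d ε β (N - n) ≤ 2 ^ n * partitionZ d ε β N := by
  induction n with
  | zero => simp
  | succ n ih =>
    have h1 := partitionZ_mul_le_succ (d := d) (n := N - (n + 1)) hε hβ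
    rw [show N - (n + 1) + 1 = N - n by omega] at h1
    have h2 : ((N - (n + 1) : ℕ) : ℝ) * (2 * ε) ^ d ≤ 1 / 2 := by
      refine le_trans ?_ h
      gcongr
      omega
    have h3 := partitionZ_nonneg (d := d) (ε := ε) hβ (N - (n + 1))
    have h4 : partitionZ d ε β (N - (n + 1)) * (1 / 2) ≤ partitionZ d ε β (N - n) :=
      le_trans (by gcongr; linarith) h1
    have h5 := ih (by omega)
    rw [pow_succ]
    linarith

/-- For N ≥ N₀ the scaling gives 2^{d+1} ε ≤ 1, so the excluded volume N(2ε)^d = 2^d ε is at most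
1/2 and removing a particle costs a factor 2. Only finitely many N remain, and each determines ε, so
their ratios can simply be added to D. -/
theorem exists_partitionZ_ratio_le (d : ℕ) (hd : 2 ≤ d) {β : ℝ} (hβ : 0 < β) :
    ∃ D : ℝ, 1 ≤ D ∧ ∀ (N : ℕ) (ε : ℝ), 0 < ε → (N : ℝ) * ε ^ (d - 1) = 1 → ∀ n ≤ N,
      (partitionZ d ε β N)⁻¹ * partitionZ d ε β (N - n) ≤ D ^ n := by
  let r : ℕ → ℕ → ℝ := fun N n =>
    (partitionZ d (((N : ℝ)⁻¹) ^ (((d - 1 : ℕ) : ℝ)⁻¹)) β N)⁻¹ *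
      partitionZ d (((N : ℝ)⁻¹) ^ (((d - 1 : ℕ) : ℝ)⁻¹)) β (N - n)
  have hr : ∀ N n, 0 ≤ r N n := fun N n =>
    mul_nonneg (inv_nonneg.2 (partitionZ_nonneg hβ _)) (partitionZ_nonneg hβ _)
  have hd1 : d - 1 ≠ 0 := by omega
  let N₀ : ℕ := (2 ^ (d + 1)) ^ (d - 1)
  have hS : 0 ≤ ∑ N ∈ Finset.range N₀, ∑ n ∈ Finset.range (N + 1), r N n :=
    Finset.sum_nonneg fun N _ => Finset.sum_nonneg fun n _ => hr N n
  refine ⟨2 + ∑ N ∈ Finset.range N₀, ∑ n ∈ Finset.range (N + 1), r N n, by linarith,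
    fun N ε hε hN n hn => ?_⟩
  set D := 2 + ∑ N ∈ Finset.range N₀, ∑ n ∈ Finset.range (N + 1), r N n with hD
  have hZ := partitionZ_nonneg (d := d) (ε := ε) hβ N
  -- For n = 0 the bound is 1; it also holds when Z_N = 0, because the inverse of 0 is 0.
  rcases Nat.eq_zero_or_pos n with rfl | hn0
  · rw [Nat.sub_zero, pow_zero]
    exact inv_mul_le_one
  by_cases hsmall : N < N₀
  · have hε' : ε = ((N : ℝ)⁻¹) ^ (((d - 1 : ℕ) : ℝ)⁻¹) := by
      rw [inv_eq_of_mul_eq_one_right hN, Real.pow_rpow_inv_natCast hε.le hd1]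
    have h1 : (partitionZ d ε β N)⁻¹ * partitionZ d ε β (N - n) = r N n := by
      simp only [r, ← hε']
    have h2 : r N n ≤ ∑ n ∈ Finset.range (N + 1), r N n :=
      Finset.single_le_sum (f := fun n => r N n) (fun n _ => hr N n)
        (Finset.mem_range.2 (by omega))
    have h3 := Finset.single_le_sum (f := fun N => ∑ n ∈ Finset.range (N + 1), r N n)
      (fun N _ => Finset.sum_nonneg fun n _ => hr N n) (Finset.mem_range.2 hsmall)
    rw [h1]
    refine le_trans ?_ (le_self_pow₀ (by linarith) hn0.ne')
    linarith
  · have hN₀ : ((2 : ℝ) ^ (d + 1)) ^ (d - 1) ≤ N := by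
      have : N₀ ≤ N := not_lt.1 hsmall
      exact_mod_cast this
    have hεle : 2 ^ (d + 1) * ε ≤ 1 := by
      have : ((2 : ℝ) ^ (d + 1) * ε) ^ (d - 1) ≤ 1 := by
        rw [mul_pow, ← hN]
        gcongr
      exact (pow_le_one_iff_of_nonneg (by positivity) hd1).1 this
    have hvol : N * (2 * ε) ^ d ≤ 1 / 2 := by
      have : N * (2 * ε) ^ d = N * ε ^ (d - 1) * (2 ^ (d + 1) * ε) / 2 := by
        have : ε ^ d = ε ^ (d - 1) * ε := by rw [← pow_succ]; congr 1; omega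
        rw [mul_pow, this]
        ring
      rw [this, hN]
      linarith
    have h := partitionZ_sub_le hε hβ hvol n hn
    calc (partitionZ d ε β N)⁻¹ * partitionZ d ε β (N - n)
        ≤ (partitionZ d ε β N)⁻¹ * (2 ^ n * partitionZ d ε β N) := by
          have := inv_nonneg.2 hZ
          gcongr
      _ = 2 ^ n * ((partitionZ d ε β N)⁻¹ * partitionZ d ε β N) := by ring
      _ ≤ 2 ^ n := mul_le_of_le_one_right (by positivity) inv_mul_le_one
      _ ≤ D ^ n := by gcongr; linarith

/-! ### Bounds on the density and its marginals, uniform in time. -/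

theorem energy_append {d n k N : ℕ} (h : N = n + k) (z : Config d n) (y : Config d k) :
    energy (fun i : Fin N => Fin.append z y (Fin.cast h i)) = energy z + energy y := by
  subst h
  simp [energy, Fin.sum_univ_add]

theorem mem_domain_of_append {d n k N : ℕ} {ε : ℝ} (h : N = n + k) {z : Config d n}
    {y : Config d k} (hz : (fun i : Fin N => Fin.append z y (Fin.cast h i)) ∈ domain d ε N) :
    y ∈ domain d ε k := by
  subst h
  intro i j hij
  simpa using hz (Fin.natAdd n i) (Fin.natAdd n j) (by simpa [Fin.ext_iff] using hij)

theorem abs_initialDensity_le {d : ℕ} {ε β : ℝ} (hβ : 0 < β) (ρ : C(Torus d, ℝ)) (N : ℕ)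
    [NeZero N] (z : Config d N) : |initialDensity ε β ρ N z| ≤
      ‖ρ‖ * (partitionZ d ε β N)⁻¹ * ((β / (2 * Real.pi)) ^ ((d : ℝ) / 2)) ^ N * weight β z := by
  have hZ := inv_nonneg.2 (partitionZ_nonneg (d := d) (ε := ε) hβ N)
  have hg := gibbs_nonneg (ε := ε) hβ z
  rw [initialDensity, abs_mul, abs_mul, abs_of_nonneg hZ, abs_of_nonneg hg]
  calc (partitionZ d ε β N)⁻¹ * |ρ (z 0).1| * gibbs ε β N z
      ≤ (partitionZ d ε β N)⁻¹ * ‖ρ‖ * ∏ i, maxwell β (z i).2 := by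
        gcongr
        · exact ρ.norm_coe_le_norm _
        · exact Set.indicator_le_self' (fun _ _ => Finset.prod_nonneg fun _ _ =>
            maxwell_nonneg hβ _) z
    _ = _ := by rw [prod_maxwell]; ring

/-- On the domain the Gibbs weight is a function of the energy, so the bound on the initial density
propagates unchanged. -/
theorem abs_density_le {d : ℕ} {ε β : ℝ} (hε : 0 < ε) (hβ : 0 < β) (ρ : C(Torus d, ℝ)) (N : ℕ)
    [NeZero N] (t : ℝ) (z : Config d N) : |density ε β ρ N t z| ≤
      ‖ρ‖ * (partitionZ d ε β N)⁻¹ * gibbs ε β N z := by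
  refine (abs_Θ_le_indicator hε t (G := fun e => ‖ρ‖ * (partitionZ d ε β N)⁻¹ *
    ((β / (2 * Real.pi)) ^ ((d : ℝ) / 2)) ^ N * Real.exp (-(β / 2) * e))
    (fun z => abs_initialDensity_le hβ ρ N z) z).trans_eq ?_
  rw [gibbs]
  by_cases hz : z ∈ domain d ε N
  · rw [Set.indicator_of_mem hz, Set.indicator_of_mem hz, prod_maxwell, weight]
    ring
  · rw [Set.indicator_of_notMem hz, Set.indicator_of_notMem hz, mul_zero]

/-- Exclusion is kept only among the particles of `y`, so that integrating them out produces
Z_{N-n}. -/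
theorem gibbs_append_le {d n k N : ℕ} {ε β : ℝ} (hβ : 0 < β) (h : N = n + k) (z : Config d n)
    (y : Config d k) : gibbs ε β N (fun i => Fin.append z y (Fin.cast h i)) ≤
      ((β / (2 * Real.pi)) ^ ((d : ℝ) / 2)) ^ n * weight β z * gibbs ε β k y := by
  have hw := (weight_pos β z).le
  by_cases hz : (fun i : Fin N => Fin.append z y (Fin.cast h i)) ∈ domain d ε N
  · rw [gibbs, gibbs, Set.indicator_of_mem hz, Set.indicator_of_mem (mem_domain_of_append h hz),
      prod_maxwell, prod_maxwell, weight, energy_append h, mul_add, Real.exp_add, weight, weight, h,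
      pow_add]
    exact le_of_eq (by ring)
  · rw [gibbs, Set.indicator_of_notMem hz]
    have := gibbs_nonneg (ε := ε) hβ y
    positivity

/-- The marginals are bounded by the Maxwell states. -/
theorem exists_abs_marginal_le (d : ℕ) (hd : 2 ≤ d) {β : ℝ} (hβ : 0 < β) :
    ∃ D : ℝ, 1 ≤ D ∧ ∀ (N : ℕ) [NeZero N] (ε : ℝ), 0 < ε → (N : ℝ) * ε ^ (d - 1) = 1 →
      ∀ (ρ : C(Torus d, ℝ)) (t : ℝ) (n : ℕ) (z : Config d n),
        |marginal ε β ρ N t n z| ≤ ‖ρ‖ * D ^ n * weight β z := by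
  obtain ⟨D, hD, hratio⟩ := exists_partitionZ_ratio_le d hd hβ
  set a := (β / (2 * Real.pi)) ^ ((d : ℝ) / 2) with ha
  have ha0 : 0 ≤ a := by positivity
  -- Here a is the normalization of M_β; 1 + a replaces it to keep the constant at least 1.
  refine ⟨D * (1 + a), by nlinarith, fun N _ ε hε hN ρ t n z => ?_⟩
  have hw := (weight_pos β z).le
  rw [marginal]
  split_ifs with hn
  · have hZ := inv_nonneg.2 (partitionZ_nonneg (d := d) (ε := ε) hβ N)
    have hint : Integrable fun y : Config d (N - n) =>
        ‖ρ‖ * (partitionZ d ε β N)⁻¹ * (a ^ n * weight β z) * gibbs ε β (N - n) y :=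
      (integrable_gibbs hβ).const_mul _
    refine (norm_integral_le_of_norm_le (f := fun y : Config d (N - n) => density ε β ρ N t
        fun i => Fin.append z y (Fin.cast (Nat.add_sub_of_le hn).symm i)) hint
      (.of_forall fun y => ?_)).trans ?_
    · refine (abs_density_le hε hβ ρ N t _).trans ?_
      rw [mul_assoc (‖ρ‖ * _)]
      gcongr
      exact gibbs_append_le hβ _ z y
    · rw [integral_const_mul]
      calc ‖ρ‖ * (partitionZ d ε β N)⁻¹ * (a ^ n * weight β z) * partitionZ d ε β (N - n)
          = ‖ρ‖ * ((partitionZ d ε β N)⁻¹ * partitionZ d ε β (N - n)) * a ^ n * weight β z := by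
            ring
        _ ≤ ‖ρ‖ * D ^ n * (1 + a) ^ n * weight β z := by
          gcongr
          · exact hratio N ε hε hN n hn
          · linarith
        _ = _ := by rw [mul_pow]; ring
  · rw [abs_zero]
    positivity

/-! ### Estimate of the remainder. -/

theorem marginal_eq_zero {d : ℕ} (ε β : ℝ) (ρ : Torus d → ℝ) {N : ℕ} [NeZero N] (t : ℝ) {n : ℕ}
    (hn : N < n) : marginal ε β ρ N t n = 0 := by
  ext z
  simp [marginal, not_le.2 hn]

theorem chain_eq_zero {d : ℕ} (ε : ℝ) {N : ℕ} {F : Family d} (hF : ∀ n, N < n → F n = 0)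
    (l : List (ℝ × ℕ)) : ∀ n, N < n → chain ε N l F n = 0 := by
  induction l with
  | nil => exact hF
  | cons a l ih =>
    intro n hn
    exact Q_eq_zero ε N a.2 n a.1 (ih _ (by omega))

theorem excess_eq_zero {d : ℕ} (ε β : ℝ) (ρ : Torus d → ℝ) {N : ℕ} [NeZero N] (t : ℝ)
    (h : ℕ → ℝ) (k n : ℕ) (hn : N < n) : excess ε β ρ N t h k n = 0 := by
  ext z
  have : ∀ s, Q ε N n (2 ^ k + s) (h k) (marginal ε β ρ N (cutTime t h k)) = 0 := fun s =>
    Q_eq_zero ε N _ n _ (marginal_eq_zero ε β ρ _ (hn.trans_le (Nat.le_add_right _ _)))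
  simp [excess, this]

/-- The estimate of the last factor of the terms of the remainder, for marginals bounded by
`‖ρ‖ D ^ n M_β^{⊗n}`. -/
theorem abs_excess_le {d : ℕ} {β : ℝ} (hβ : 0 < β) {ε : ℝ} (hε : 0 < ε) {N : ℕ} [NeZero N]
    (hN : (N : ℝ) * ε ^ (d - 1) = 1) {r D : ℝ} (hr : 1 ≤ r) (hD : 1 ≤ D) (ρ : C(Torus d, ℝ))
    (hρ : ∀ (t : ℝ) (n : ℕ) (z : Config d n), |marginal ε β ρ N t n z| ≤ ‖ρ‖ * D ^ n * weight β z)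
    (t : ℝ) (h : ℕ → ℝ) (k : ℕ) (hk : 0 ≤ h k)
    (hq : lossConst d β * r * h k * Real.exp 1 * D ≤ 1 / 2) (n : ℕ) (z : Config d n) :
    |excess ε β ρ N t h k n z| ≤ 2 * ‖ρ‖ * (Real.exp 1 * D) ^ n *
      (lossConst d β * r * h k * Real.exp 1 * D) ^ 2 ^ k * weight (β - β / (2 * r ^ 2)) z := by
  have hκ := lossConst_pos d hβ
  have hr0 : 0 < r := by linarith
  set q := lossConst d β * r * h k * Real.exp 1 * D with hqdef
  have hq0 : 0 ≤ q := by positivity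
  have hw := (weight_pos (β - β / (2 * r ^ 2)) z).le
  have hδ : β / 2 + β / (2 * r ^ 2) ≤ β := by
    have : β / (2 * r ^ 2) ≤ β / 2 := by
      apply div_le_div_of_nonneg_left hβ.le (by positivity)
      nlinarith
    linarith
  have hterm : ∀ s, |Q ε N n (2 ^ k + s) (h k) (marginal ε β ρ N (cutTime t h k)) z| ≤
      ‖ρ‖ * (Real.exp 1 * D) ^ n * q ^ 2 ^ k * weight (β - β / (2 * r ^ 2)) z * q ^ s := by
    intro s
    by_cases hns : n + (2 ^ k + s) ≤ N
    · refine (abs_Q_le hβ hε hN (A := ‖ρ‖ * D ^ (n + (2 ^ k + s))) (by positivity) hr hk hns hδ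
        (fun z => hρ _ _ z) z).trans_eq ?_
      have hexp : Real.exp ((n : ℝ) + (2 ^ k + s : ℕ)) =
          Real.exp 1 ^ n * Real.exp 1 ^ (2 ^ k) * Real.exp 1 ^ s := by
        rw [← pow_add, ← pow_add, ← Real.exp_nat_mul]
        push_cast
        ring_nf
      rw [hexp, hqdef, pow_add, pow_add, pow_add]
      simp only [mul_pow]
      ring
    · rw [Q_eq_zero ε N _ n _ (marginal_eq_zero ε β ρ _ (not_le.1 hns))]
      simp only [Pi.zero_apply, abs_zero]
      positivity
  -- Each collision beyond the 2^k-th gains a factor q ≤ 1/2, so the sum costs at most 2.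
  have hgeo := (hasSum_geometric_of_lt_one hq0 (by linarith)).mul_left
    (‖ρ‖ * (Real.exp 1 * D) ^ n * q ^ 2 ^ k * weight (β - β / (2 * r ^ 2)) z)
  have hinv : (1 - q)⁻¹ ≤ 2 := by
    rw [inv_le_comm₀ (by linarith) (by norm_num)]
    linarith
  refine (tsum_of_norm_bounded
    (f := fun s => Q ε N n (2 ^ k + s) (h k) (marginal ε β ρ N (cutTime t h k)) z)
    hgeo hterm).trans ?_
  calc ‖ρ‖ * (Real.exp 1 * D) ^ n * q ^ 2 ^ k * weight (β - β / (2 * r ^ 2)) z * (1 - q)⁻¹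
      ≤ ‖ρ‖ * (Real.exp 1 * D) ^ n * q ^ 2 ^ k * weight (β - β / (2 * r ^ 2)) z * 2 := by gcongr
    _ = _ := by ring

/-- The estimate of a chain of operators creating at most `2 ^ p, 2 ^ (p + 1), …` particles. -/
theorem abs_chain_le {d : ℕ} {β : ℝ} (hβ : 0 < β) {ε : ℝ} (hε : 0 < ε) {N : ℕ}
    (hN : (N : ℝ) * ε ^ (d - 1) = 1) {A b r : ℝ} (hA : 0 ≤ A) (hr : 1 ≤ r) {F : Family d}
    (hF0 : ∀ n, N < n → F n = 0) (m : ℕ) :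
    ∀ (p : ℕ) (f : Fin m → ℝ × ℕ),
      (∀ i, 0 ≤ (f i).1 ∧ lossConst d β * r * (f i).1 ≤ 1 ∧ (f i).2 ≤ 2 ^ (p + i)) →
      (∀ n ≤ 2 ^ (p + m), ∀ z, |F n z| ≤ A * weight b z) →
      β / 2 + m * (β / (2 * r ^ 2)) ≤ b → ∀ n ≤ 2 ^ p, ∀ z,
      |chain ε N (List.ofFn f) F n z| ≤ A * Real.exp (2 ^ (p + m + 1) - 2 ^ (p + 1)) *
        weight (b - m * (β / (2 * r ^ 2))) z := by
  have hκ := lossConst_pos d hβ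
  have hr0 : 0 < r := by linarith
  induction m with
  | zero =>
    intro p f _ hF _ n hn z
    simpa [chain] using hF n hn z
  | succ m ih =>
    intro p f hf hF hb n hn z
    push_cast at hb
    have hδ : 0 ≤ β / (2 * r ^ 2) := by positivity
    obtain ⟨hf1, hf2, hf3⟩ := hf 0
    have hw := (weight_pos (b - (m + 1 : ℕ) * (β / (2 * r ^ 2))) z).le
    have ih' := ih (p + 1) (fun i => f i.succ) (fun i => by
      refine ⟨(hf i.succ).1, (hf i.succ).2.1, (hf i.succ).2.2.trans_eq ?_⟩
      rw [Fin.val_succ]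
      congr 1
      omega) (fun n hn => hF n (hn.trans_eq (by congr 1; omega))) (by linarith)
    rw [List.ofFn_succ]
    change |Q ε N n (f 0).2 (f 0).1 (chain ε N (List.ofFn fun i => f i.succ) F) z| ≤ _
    have hnj : n + (f 0).2 ≤ 2 ^ (p + 1) := by
      rw [Fin.val_zero, add_zero] at hf3
      rw [pow_succ]
      omega
    by_cases hle : n + (f 0).2 ≤ N
    · refine (abs_Q_le hβ hε hN (mul_nonneg hA (Real.exp_pos _).le) hr hf1 hle
        (by linarith) (ih' _ hnj) z).trans ?_
      have hwt : b - m * (β / (2 * r ^ 2)) - β / (2 * r ^ 2) =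
          b - (m + 1 : ℕ) * (β / (2 * r ^ 2)) := by push_cast; ring
      rw [hwt]
      refine mul_le_mul_of_nonneg_right ?_ hw
      have hnj' : (n : ℝ) + (f 0).2 ≤ 2 ^ (p + 1) := by exact_mod_cast hnj
      -- The smallness of these factors is discarded. Only e^{n+j} ≤ exp(2^{p+1}) is kept, and the
      -- exponents 2^{p+1}, ..., 2^{p+m} sum to 2^{p+m+1} - 2^{p+1}.
      have hpow : (lossConst d β * r * (f 0).1) ^ (f 0).2 ≤ 1 :=
        pow_le_one₀ (by positivity) hf2
      calc A * Real.exp (2 ^ (p + 1 + m + 1) - 2 ^ (p + 1 + 1)) *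
            (lossConst d β * r * (f 0).1) ^ (f 0).2 * Real.exp (n + (f 0).2)
          ≤ A * Real.exp (2 ^ (p + 1 + m + 1) - 2 ^ (p + 1 + 1)) * 1 *
            Real.exp (2 ^ (p + 1)) := by gcongr
        _ = A * Real.exp (2 ^ (p + (m + 1) + 1) - 2 ^ (p + 1)) := by
          rw [mul_one, mul_assoc, ← Real.exp_add, show p + 1 + m + 1 = p + (m + 1) + 1 by omega,
            pow_succ 2 (p + 1)]
          ring_nf
    · rw [Q_eq_zero ε N _ n _ (chain_eq_zero ε hF0 _ _ (not_le.1 hle))]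
      simp only [Pi.zero_apply, abs_zero]
      positivity

theorem card_piFinset_range_two_pow_le (m : ℕ) :
    (Fintype.piFinset fun i : Fin m => Finset.range (2 ^ ((i : ℕ) + 1))).card ≤ 2 ^ 2 ^ (m + 1) := by
  rw [Fintype.card_piFinset]
  simp only [Finset.card_range]
  induction m with
  | zero => simp
  | succ m ih =>
    rw [Fin.prod_univ_castSucc]
    simp only [Fin.val_castSucc, Fin.val_last]
    have h1 : 2 ^ (m + 1) ≤ 2 ^ 2 ^ (m + 1) :=
      Nat.pow_le_pow_right (by norm_num) Nat.lt_two_pow_self.le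
    calc _ ≤ 2 ^ 2 ^ (m + 1) * 2 ^ 2 ^ (m + 1) := Nat.mul_le_mul ih h1
      _ = 2 ^ 2 ^ (m + 1 + 1) := by rw [← pow_add]; congr 1; ring

theorem sum_half_pow_le_one (K : ℕ) : ∑ k ∈ Finset.Icc 1 K, (1 / 2 : ℝ) ^ k ≤ 1 := by
  have : ∑ k ∈ Finset.Icc 1 K, (1 / 2 : ℝ) ^ k = 1 - (1 / 2) ^ K := by
    induction K with
    | zero => simp
    | succ K ih =>
      rw [Finset.sum_Icc_succ_top (by omega), ih, pow_succ]
      ring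
  rw [this]
  have : (0 : ℝ) < (1 / 2) ^ K := by positivity
  linarith

/-- The estimate of the remainder for times `h_k` that decrease doubly exponentially away from the
end of the cutting. -/
theorem abs_remainder_le {d : ℕ} {β : ℝ} (hβ : 0 < β) {ε : ℝ} (hε : 0 < ε) {N : ℕ} [NeZero N]
    (hN : (N : ℝ) * ε ^ (d - 1) = 1) {D : ℝ} (hD : 1 ≤ D) (ρ : C(Torus d, ℝ))
    (hρ : ∀ (t : ℝ) (n : ℕ) (z : Config d n), |marginal ε β ρ N t n z| ≤ ‖ρ‖ * D ^ n * weight β z)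
    {K : ℕ} (hK : 1 ≤ K) (t y : ℝ) (h : ℕ → ℝ) (hh : ∀ k ∈ Finset.Icc 1 K, 0 < h k ∧
      2 * Real.exp 4 * D ^ 2 * lossConst d β * √K * h k ≤
        Real.exp (-(2 : ℝ) ^ (y - k)) / 4) (z : Phase d) :
    |remainder ε β ρ N K t h z| ≤ ‖ρ‖ * Real.exp (-(2 : ℝ) ^ y) := by
  have hκ := lossConst_pos d hβ
  have hK' : (1 : ℝ) ≤ K := by exact_mod_cast hK
  have hr : 1 ≤ √(K : ℝ) := Real.one_le_sqrt.2 hK'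
  have hr2 : √(K : ℝ) ^ 2 = K := Real.sq_sqrt (by linarith)
  have hr0 : 0 < √(K : ℝ) := by linarith
  set r := √(K : ℝ) with hrdef
  have he : 1 ≤ Real.exp 1 := Real.one_le_exp zero_le_one
  have he4 : Real.exp 4 = Real.exp 1 ^ 4 := by rw [← Real.exp_nat_mul]; norm_num
  have hsmall : ∀ k ∈ Finset.Icc 1 K, lossConst d β * r * h k * Real.exp 1 * D ≤ 1 / 2 ∧
      lossConst d β * r * h k ≤ 1 := by
    intro k hk
    obtain ⟨hk0, hkle⟩ := hh k hk
    have h1 : Real.exp (-(2 : ℝ) ^ (y - k)) ≤ 1 := by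
      rw [Real.exp_le_one_iff, neg_nonpos]
      positivity
    have hX : 0 ≤ lossConst d β * r * h k := by positivity
    have h2 : lossConst d β * r * h k * (Real.exp 1 * D) ≤ 1 / 8 := by
      have : lossConst d β * r * h k * (Real.exp 1 * D) * 1 ≤
          lossConst d β * r * h k * (Real.exp 1 * D) * (Real.exp 1 ^ 3 * D) := by
        gcongr
        exact one_le_mul_of_one_le_of_one_le (one_le_pow₀ he) hD
      rw [he4] at hkle
      linear_combination this + hkle / 2 + h1 / 8
    refine ⟨by rw [mul_assoc]; linarith, ?_⟩
    have : lossConst d β * r * h k * 1 ≤ lossConst d β * r * h k * (Real.exp 1 * D) := by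
      gcongr
      exact one_le_mul_of_one_le_of_one_le he hD
    linarith
  have hterm : ∀ k ∈ Finset.Icc 1 K, ∀ j ∈ Fintype.piFinset
      fun i : Fin (k - 1) => Finset.range (2 ^ ((i : ℕ) + 1)),
      |chain ε N (List.ofFn fun i : Fin (k - 1) => (h ((i : ℕ) + 1), j i))
        (excess ε β ρ N t h k) 1 fun _ => z| ≤
      2 * ‖ρ‖ * (Real.exp 4 * D ^ 2 * lossConst d β * r * h k) ^ 2 ^ k := by
    intro k hk j hj
    obtain ⟨hk1, hkK⟩ := Finset.mem_Icc.1 hk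
    have hk0 := (hh k hk).1.le
    have hkK' : (k : ℝ) ≤ K := by exact_mod_cast hkK
    set q := lossConst d β * r * h k * Real.exp 1 * D with hq
    have hq0 : 0 ≤ q := by positivity
    have heD : 1 ≤ Real.exp 1 * D := one_le_mul_of_one_le_of_one_le he hD
    -- The choice r² = K: the k ≤ K operators together lose at most β/2, so b stays above the
    -- threshold β/2.
    have hKδ : (K : ℝ) * (β / (2 * r ^ 2)) = β / 2 := by
      rw [hr2]
      field_simp
    have hδ : 0 ≤ β / (2 * r ^ 2) := by positivity
    have hkδ : (k : ℝ) * (β / (2 * r ^ 2)) ≤ β / 2 := hKδ ▸ by gcongr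
    have hkc : ((k - 1 : ℕ) : ℝ) = k - 1 := by push_cast [hk1]; ring
    have := abs_chain_le hβ hε hN
      (A := 2 * ‖ρ‖ * (Real.exp 1 * D) ^ 2 ^ k * q ^ 2 ^ k) (b := β - β / (2 * r ^ 2))
      (by positivity) hr (excess_eq_zero ε β ρ t h k) (k - 1) 1
      (fun i => (h ((i : ℕ) + 1), j i)) (fun i => by
        have hi : (i : ℕ) + 1 ∈ Finset.Icc 1 K := Finset.mem_Icc.2 ⟨by omega, by omega⟩
        refine ⟨(hh _ hi).1.le, (hsmall _ hi).2, ?_⟩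
        rw [add_comm 1]
        exact (Finset.mem_range.1 (Fintype.mem_piFinset.1 hj i)).le)
      (fun n hn z => by
        rw [show 1 + (k - 1) = k by omega] at hn
        have hw := (weight_pos (β - β / (2 * r ^ 2)) z).le
        refine (abs_excess_le hβ hε hN hr hD ρ hρ t h k hk0 (hsmall k hk).1 n z).trans ?_
        gcongr)
      (by rw [hkc]; linarith) 1 (by norm_num) (fun _ => z)
    refine this.trans ?_
    rw [show 1 + (k - 1) + 1 = k + 1 by omega]
    have hw1 : weight (β - β / (2 * r ^ 2) - (k - 1 : ℕ) * (β / (2 * r ^ 2)))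
        (fun _ => z : Config d 1) ≤ 1 := weight_le_one (by rw [hkc]; linarith) _
    have hw0 := (weight_pos (β - β / (2 * r ^ 2) - (k - 1 : ℕ) * (β / (2 * r ^ 2)))
        (fun _ => z : Config d 1)).le
    have hexp : Real.exp ((2 : ℝ) ^ (k + 1) - 2 ^ (1 + 1)) ≤ (Real.exp 1 ^ 2) ^ 2 ^ k := by
      rw [← pow_mul, ← Real.exp_nat_mul]
      gcongr
      push_cast
      rw [pow_succ]
      linarith
    -- Per unit of 2^k, the excess gives eD from its at most 2^k initial particles and another eD
    -- inside q, and the chain gives e²; hence e⁴D².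
    calc 2 * ‖ρ‖ * (Real.exp 1 * D) ^ 2 ^ k * q ^ 2 ^ k *
          Real.exp ((2 : ℝ) ^ (k + 1) - 2 ^ (1 + 1)) *
          weight (β - β / (2 * r ^ 2) - (k - 1 : ℕ) * (β / (2 * r ^ 2))) (fun _ => z : Config d 1)
        ≤ 2 * ‖ρ‖ * (Real.exp 1 * D) ^ 2 ^ k * q ^ 2 ^ k * (Real.exp 1 ^ 2) ^ 2 ^ k * 1 := by
          gcongr
      _ = 2 * ‖ρ‖ * (Real.exp 1 * D * q * Real.exp 1 ^ 2) ^ 2 ^ k := by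
          simp only [mul_pow]; ring
      _ = _ := by rw [hq, he4]; ring_nf
  have hk_sum : ∀ k ∈ Finset.Icc 1 K,
      |∑ j ∈ Fintype.piFinset fun i : Fin (k - 1) => Finset.range (2 ^ ((i : ℕ) + 1)),
        chain ε N (List.ofFn fun i : Fin (k - 1) => (h ((i : ℕ) + 1), j i))
          (excess ε β ρ N t h k) 1 fun _ => z| ≤
      ‖ρ‖ * Real.exp (-(2 : ℝ) ^ y) * (1 / 2) ^ k := by
    intro k hk
    have hk1 := (Finset.mem_Icc.1 hk).1
    obtain ⟨hk0, hkle⟩ := hh k hk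
    set X := Real.exp 4 * D ^ 2 * lossConst d β * r * h k with hX
    have hX0 : 0 ≤ X := by positivity
    have hcard : (((Fintype.piFinset fun i : Fin (k - 1) =>
        Finset.range (2 ^ ((i : ℕ) + 1))).card : ℕ) : ℝ) ≤ 2 ^ 2 ^ k := by
      have := card_piFinset_range_two_pow_le (k - 1)
      rw [Nat.sub_add_cancel hk1] at this
      exact_mod_cast this
    have hexp : Real.exp (-(2 : ℝ) ^ (y - k)) ^ 2 ^ k = Real.exp (-(2 : ℝ) ^ y) := by
      rw [← Real.exp_nat_mul]
      congr 1
      rw [Real.rpow_sub two_pos, Real.rpow_natCast]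
      push_cast
      field_simp
    -- In `hh`, the factor 2 absorbs the number of the j, and the factor 1/4 makes the sum over k
    -- converge.
    have hquarter : 2 * (1 / 4 : ℝ) ^ 2 ^ k ≤ (1 / 2) ^ k := by
      have h1 : (1 / 4 : ℝ) ^ 2 ^ k ≤ (1 / 4) ^ k :=
        pow_le_pow_of_le_one (by norm_num) (by norm_num) Nat.lt_two_pow_self.le
      have h2 : (1 / 4 : ℝ) ^ k = (1 / 2) ^ k * (1 / 2) ^ k := by
        rw [← mul_pow]; norm_num
      have h3 : (1 / 2 : ℝ) ^ k ≤ (1 / 2) ^ 1 :=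
        pow_le_pow_of_le_one (by norm_num) (by norm_num) hk1
      have h4 : (0 : ℝ) < (1 / 2) ^ k := by positivity
      nlinarith
    calc _ ≤ ∑ j ∈ Fintype.piFinset fun i : Fin (k - 1) => Finset.range (2 ^ ((i : ℕ) + 1)),
          2 * ‖ρ‖ * X ^ 2 ^ k :=
          (Finset.abs_sum_le_sum_abs _ _).trans (Finset.sum_le_sum fun j hj => hterm k hk j hj)
      _ ≤ 2 ^ 2 ^ k * (2 * ‖ρ‖ * X ^ 2 ^ k) := by
        rw [Finset.sum_const, nsmul_eq_mul]
        gcongr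
      _ = 2 * ‖ρ‖ * (2 * X) ^ 2 ^ k := by rw [mul_pow]; ring
      _ ≤ 2 * ‖ρ‖ * (Real.exp (-(2 : ℝ) ^ (y - k)) / 4) ^ 2 ^ k := by
        gcongr
        rw [hX]
        linarith
      _ = ‖ρ‖ * Real.exp (-(2 : ℝ) ^ y) * (2 * (1 / 4) ^ 2 ^ k) := by
        rw [div_pow, hexp, div_pow, one_pow]; ring
      _ ≤ _ := by gcongr
  calc |remainder ε β ρ N K t h z|
      ≤ ∑ k ∈ Finset.Icc 1 K, ‖ρ‖ * Real.exp (-(2 : ℝ) ^ y) * (1 / 2) ^ k :=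
        (Finset.abs_sum_le_sum_abs _ _).trans (Finset.sum_le_sum hk_sum)
    _ ≤ ‖ρ‖ * Real.exp (-(2 : ℝ) ^ y) * 1 := by
      rw [← Finset.mul_sum]
      gcongr
      exact sum_half_pow_le_one K
    _ = _ := mul_one _

/-! ### Choice of the time steps. -/

/-- For k ≥ K - L the inner exponent is nonpositive and the summand is at least e^{-1}; the last ⌊L⌋
≥ L/2 indices are of this kind. -/
theorem le_sum_exp_neg_two_rpow {K : ℕ} {L : ℝ} (hL1 : 1 ≤ L) (hLK : L ≤ K) :
    Real.exp (-1) * (L / 2) ≤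
      ∑ k ∈ Finset.Icc 1 K, Real.exp (-(2 : ℝ) ^ ((K : ℝ) - L - k)) := by
  have hf1 : 1 ≤ ⌊L⌋₊ := Nat.one_le_floor_iff L |>.2 hL1
  have hfL : (⌊L⌋₊ : ℝ) ≤ L := Nat.floor_le (by linarith)
  have hfK : ⌊L⌋₊ ≤ K := by exact_mod_cast hfL.trans hLK
  have hLf : L / 2 ≤ ⌊L⌋₊ := by
    have h1 := Nat.lt_floor_add_one L
    have h2 : (1 : ℝ) ≤ ⌊L⌋₊ := by exact_mod_cast hf1
    linarith
  calc Real.exp (-1) * (L / 2) ≤ Real.exp (-1) * ⌊L⌋₊ := by gcongr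
    _ = ∑ k ∈ Finset.Icc (K - ⌊L⌋₊ + 1) K, Real.exp (-1) := by
      rw [Finset.sum_const, Nat.card_Icc, nsmul_eq_mul, mul_comm]
      congr 2
      omega
    _ ≤ ∑ k ∈ Finset.Icc (K - ⌊L⌋₊ + 1) K, Real.exp (-(2 : ℝ) ^ ((K : ℝ) - L - k)) := by
      refine Finset.sum_le_sum fun k hk => ?_
      rw [Real.exp_le_exp, neg_le_neg_iff]
      apply Real.rpow_le_one_of_one_le_of_nonpos (by norm_num)
      have h1 : K + 1 ≤ k + ⌊L⌋₊ := by
        have := (Finset.mem_Icc.1 hk).1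
        omega
      have h2 : (K : ℝ) + 1 ≤ k + ⌊L⌋₊ := by exact_mod_cast h1
      linarith
    _ ≤ _ := by
      refine Finset.sum_le_sum_of_subset_of_nonneg (Finset.Icc_subset_Icc (by omega) le_rfl)
        fun k _ _ => (Real.exp_pos _).le

end HardSphere

end

theorem mainTheorem2 (d : ℕ) (hd : 2 ≤ d) (β : ℝ) (hβ : 0 < β) :
    ∃ c : ℝ, 0 < c ∧ ∀ α : ℝ, 0 < α → α < 1 / 2 → ∃ K₀ : ℕ, ∀ K : ℕ, K₀ ≤ K →
      ∀ t : ℝ, 0 < t → t ≤ c * (K : ℝ) ^ (1 / 2 - α) →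
        ∃ h : ℕ → ℝ, (∀ i ∈ Finset.Icc 1 K, 0 < h i) ∧ ∑ i ∈ Finset.Icc 1 K, h i = t ∧
          ∀ (N : ℕ) [NeZero N] (ε : ℝ), 0 < ε → (N : ℝ) * ε ^ (d - 1) = 1 →
            ∀ ρ : C(HardSphere.Torus d, ℝ),
              MeasureTheory.eLpNorm (HardSphere.remainder ε β ρ N K t h) ⊤
                  MeasureTheory.volume ≤
                ENNReal.ofReal
                  (‖ρ‖ * Real.exp (-(2 : ℝ) ^ ((K : ℝ) - (K : ℝ) ^ (1 - α)))) := by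
  obtain ⟨D, hD, hmarg⟩ := HardSphere.exists_abs_marginal_le d hd hβ
  have hκ := HardSphere.lossConst_pos d hβ
  set M := 2 * Real.exp 4 * D ^ 2 * HardSphere.lossConst d β with hM
  have hM0 : 0 < M := by positivity
  -- The 8 combines the 1/4 required by `abs_remainder_le` with the lower bound e^{-1} L/2 for B.
  -- The threshold K₀ = 1 serves every α.
  refine ⟨Real.exp (-1) / (8 * M), by positivity, fun α hα hα2 => ⟨1, fun K hK t ht htK => ?_⟩⟩
  have hK1 : (1 : ℝ) ≤ K := by exact_mod_cast hK
  have hK0 : (0 : ℝ) < K := by linarith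
  set L := (K : ℝ) ^ (1 - α) with hL
  have hL1 : 1 ≤ L := Real.one_le_rpow hK1 (by linarith)
  have hLK : L ≤ K := by
    simpa using Real.rpow_le_rpow_of_exponent_le hK1 (show 1 - α ≤ 1 by linarith)
  set b : ℕ → ℝ := fun k => Real.exp (-(2 : ℝ) ^ ((K : ℝ) - L - k)) with hb
  set B := ∑ k ∈ Finset.Icc 1 K, b k with hB
  have hBle : Real.exp (-1) * (L / 2) ≤ B := HardSphere.le_sum_exp_neg_two_rpow hL1 hLK
  have hB0 : 0 < B := lt_of_lt_of_le (by positivity) hBle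
  have hrate : M * √K * (t / B) ≤ 1 / 4 := by
    -- The exponent 1/2 - α arises here: about L = K^{1-α} useful steps, each of length of order
    -- 1/√K.
    have hsqrt : √(K : ℝ) * (K : ℝ) ^ (1 / 2 - α) = L := by
      rw [Real.sqrt_eq_rpow, ← Real.rpow_add hK0, hL]
      ring_nf
    rw [mul_div_assoc', div_le_iff₀ hB0]
    calc M * √K * t ≤ M * √K * (Real.exp (-1) / (8 * M) * (K : ℝ) ^ (1 / 2 - α)) := by gcongr
      _ = Real.exp (-1) / 8 * (√(K : ℝ) * (K : ℝ) ^ (1 / 2 - α)) := by field_simp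
      _ = 1 / 4 * (Real.exp (-1) * (L / 2)) := by rw [hsqrt]; ring
      _ ≤ 1 / 4 * B := by gcongr
  have hh : ∀ k ∈ Finset.Icc 1 K, 0 < t / B * b k ∧
      2 * Real.exp 4 * D ^ 2 * HardSphere.lossConst d β * √K * (t / B * b k) ≤
        Real.exp (-(2 : ℝ) ^ ((K : ℝ) - L - k)) / 4 := by
    intro k _
    have hbk : 0 < b k := Real.exp_pos _
    refine ⟨by positivity, ?_⟩
    calc 2 * Real.exp 4 * D ^ 2 * HardSphere.lossConst d β * √K * (t / B * b k)
        = M * √K * (t / B) * b k := by rw [hM]; ring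
      _ ≤ 1 / 4 * b k := by gcongr
      _ = _ := by rw [hb]; ring
  refine ⟨fun k => t / B * b k, fun k hk => (hh k hk).1, ?_, fun N _ ε hε hN ρ => ?_⟩
  · rw [← Finset.mul_sum, ← hB, div_mul_cancel₀ _ hB0.ne']
  · rw [MeasureTheory.eLpNorm_exponent_top]
    exact MeasureTheory.eLpNormEssSup_le_of_ae_bound (.of_forall fun z =>
      HardSphere.abs_remainder_le hβ hε hN hD ρ (hmarg N ε hε hN ρ) hK t ((K : ℝ) - L) _ hh z)
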